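/- Let $p\ge 1$ and $\mathbb N=\{1,2,\dots\}$. Let $(\boldsymbol Z_k)_{k\ge 0}$ be a $p$-type branching process with random migration (MBPM): $\boldsymbol Z_0$ is a $\mathbb Z_+^p$-valued random vector and $$\boldsymbol Z_{k+1}=\sum_{i=1}^p\ \sum_{j=1}^{Z_{k,i}+M_{k,i}(\boldsymbol Z_k)}\boldsymbol X_{k,j,i},\qquad k\ge 0,$$ where all the random vectors $\boldsymbol Z_0$, $\boldsymbol X_{k,j,i}$, $\boldsymbol M_k(\boldsymbol z)$ ($k\ge 0$, $j\ge 1$, $1\le i\le p$, $\boldsymbol z\in\mathbb Z_+^p$) are independent; the $\boldsymbol X_{k,j,i}$ are $\mathbb Z_+^p$-valued, for each $i$ identically distributed, with finite covariance matrix; and for each $\boldsymbol z$ the $\mathbb Z^p$-valued vectors $\boldsymbol M_k(\boldsymbol z)$, $k\ge0$, are identically distributed with finite mean $\boldsymbol h(\boldsymbol z)=E[\boldsymbol M_0(\boldsymbol z)]$. Here $M_{k,i}(\boldsymbol z)$ equals $0$ with probability $p_i(\boldsymbol z)$, equals $I_{k,i}(\boldsymbol z)$ (immigration) with probability $q_i(\boldsymbol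 z)$ and equals $-D_{k,i}(\boldsymbol z)$ (emigration) with probability $r_i(\boldsymbol z)$, where $p_i+q_i+r_i=1$, $r_i(\boldsymbol z)=0$ if $z_i=0$, the choice among the three being independent of $I_{k,i}(\boldsymbol z)$ and of $D_{k,i}(\boldsymbol z)$; the vectors $\boldsymbol I_k(\boldsymbol z)$ are $\mathbb N^p$-valued and identically distributed in $k$, the vectors $\boldsymbol D_k(\boldsymbol z)$ are $\mathbb Z_+^p$-valued and identically distributed in $k$, $D_{k,i}(\boldsymbol z)=0$ if $z_i=0$, and $1\le D_{k,i}(\boldsymbol z)\le z_i$ if $z_i>0$. Assume that $\boldsymbol Z_n\neq\boldsymbol 0$ for some $n$ with positive probability, and that: (A) the mean matrix $\mathsf m$, whose $i$-th column is $E[\boldsymbol X_{0,1,i}]$, is primitive with Perron--Frobenius eigenvalue $1$; let $\boldsymbol u$ be its left eigenvector for the eigenvalue $1$ with positive coordinates of sum $1$; (B) $h_i(\boldsymbol z)=o(\|\boldsymbol z\|)$ as $\|\boldsymbol z\|\to\infty$, for every $i$; (C) for every non-null $\boldsymbol z\in\mathbb Z_+^p$, with $A(\boldsymbol z)=\{i: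 z_i>0\}$, $$P\big(M_{0,i}(\boldsymbol z)=I_{0,i}(\boldsymbol z)>0 \text{ and } \boldsymbol X_{0,j,i}\ne\boldsymbol 0 \text{ for all } i\in A(\boldsymbol z),\ 1\le j\le z_i+I_{0,i}(\boldsymbol z)\big)>0 .$$ Let $\sigma^2(\boldsymbol z)=\mathrm{Var}(\boldsymbol u^\top\boldsymbol Z_{n+1}\mid\boldsymbol Z_n=\boldsymbol z)$. Suppose that $$\liminf_{\|\boldsymbol z\|\to\infty}\frac{2(\boldsymbol u^\top\boldsymbol z)(\boldsymbol u^\top\boldsymbol h(\boldsymbol z))}{\sigma^2(\boldsymbol z)}>1$$ (a quotient with positive numerator and $\sigma^2(\boldsymbol z)=0$ being $+\infty$) and that, for some $0<\delta\le 1$ and $\alpha>0$ and every $i\in\{1,\dots,p\}$, as $\|\boldsymbol z\|\to\infty$, $$E\big[|z_i+M_{0,i}(\boldsymbol z)|^{1+\delta/2}\big]=o\!\left(\frac{(\boldsymbol u^\top\boldsymbol z)^{1+\delta}\,(\boldsymbol u^\top\boldsymbol h(\boldsymbol z))}{(\log(\boldsymbol u^\top\boldsymbol z))^{1+\alpha}}\right),\qquad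 E\big[|M_{0,i}(\boldsymbol z)-h_i(\boldsymbol z)|^{2+\delta}\big]=o\!\left(\frac{(\boldsymbol u^\top\boldsymbol z)^{1+\delta}\,(\boldsymbol u^\top\boldsymbol h(\boldsymbol z))}{(\log(\boldsymbol u^\top\boldsymbol z))^{1+\alpha}}\right).$$ Then $P(\|\boldsymbol Z_n\|\to\infty)>0$. -/

import Mathlib

open MeasureTheory ProbabilityTheory Filter Asymptotics

namespace Migration

/-- The three regimes of the migration mechanism of one type in one generation. -/
inductive Regime where
  | none
  | immigration
  | emigration

instance : MeasurableSpace Regime := ⊤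

/-- Indices of the independent family: the initial generation, the offspring vectors
`X_{k,j,i}` and the migration vectors `M_k(z)`. -/
inductive Source (p : ℕ) where
  | initial
  | offspring (k j : ℕ) (i : Fin p)
  | migration (k : ℕ) (z : Fin p → ℕ)

/-- The number of migrants of one type, given the regime, the number `a` of potential immigrants
and the number `d` of potential emigrants. -/
def migrants : Regime → ℕ → ℕ → ℤ
  | Regime.none, _, _ => 0
  | Regime.immigration, a, _ => (a : ℤ)
  | Regime.emigration, _, d => -(d : ℤ)

/-- The independent family `Z_0`, `X_{k,j,i}`, `M_k(z)`, as `ℤ^p`-valued random vectors. -/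
def source {Ω : Type*} {p : ℕ} (Z0 : Ω → Fin p → ℕ) (X : ℕ → ℕ → Fin p → Ω → Fin p → ℕ)
    (M : ℕ → (Fin p → ℕ) → Ω → Fin p → ℤ) : Source p → Ω → Fin p → ℤ
  | Source.initial => fun ω l => (Z0 ω l : ℤ)
  | Source.offspring k j i => fun ω l => (X k j i ω l : ℤ)
  | Source.migration k z => M k z

/-- The data of a multitype branching process with random migration, with `p` types, on the
probability space `(Ω, P)`. Individuals are numbered from `j = 0`. -/
structure MBPM {Ω : Type*} [MeasurableSpace Ω] (P : Measure Ω) (p : ℕ) where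
  /-- The initial generation `Z_0`. -/
  Z0 : Ω → Fin p → ℕ
  /-- `X k j i ω l`: number of children of type `l` of the `j`-th individual of type `i` in
  generation `k`. -/
  X : ℕ → ℕ → Fin p → Ω → Fin p → ℕ
  /-- `I k z`: potential immigrants in generation `k` when its composition is `z`. -/
  I : ℕ → (Fin p → ℕ) → Ω → Fin p → ℕ
  /-- `D k z`: potential emigrants in generation `k` when its composition is `z`. -/
  D : ℕ → (Fin p → ℕ) → Ω → Fin p → ℕ
  /-- `R k z ω i`: the regime (no migration, immigration, emigration) which occurs for type `i`. -/
  R : ℕ → (Fin p → ℕ) → Ω → Fin p → Regime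
  /-- `p_i(z)`, the probability of no migration. -/
  probNone : (Fin p → ℕ) → Fin p → ℝ
  /-- `q_i(z)`, the probability of immigration. -/
  probImm : (Fin p → ℕ) → Fin p → ℝ
  /-- `r_i(z)`, the probability of emigration. -/
  probEm : (Fin p → ℕ) → Fin p → ℝ
  measurable_Z0 : Measurable Z0
  measurable_X : ∀ k j i, Measurable (X k j i)
  measurable_I : ∀ k z, Measurable (I k z)
  measurable_D : ∀ k z, Measurable (D k z)
  measurable_R : ∀ k z, Measurable (R k z)
  /-- The immigration vectors take values in the vectors of positive integers. -/
  I_pos : ∀ k z ω i, 1 ≤ I k z ω i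
  D_eq_zero : ∀ k z ω i, z i = 0 → D k z ω i = 0
  D_range : ∀ k z ω i, 0 < z i → 1 ≤ D k z ω i ∧ D k z ω i ≤ z i
  prob_none : ∀ k z i, P.real {ω | R k z ω i = Regime.none} = probNone z i
  prob_imm : ∀ k z i, P.real {ω | R k z ω i = Regime.immigration} = probImm z i
  prob_em : ∀ k z i, P.real {ω | R k z ω i = Regime.emigration} = probEm z i
  probEm_eq_zero : ∀ z i, z i = 0 → probEm z i = 0
  /-- The regime of a type is drawn independently of its immigration variable. -/
  indep_R_I : ∀ k z i, IndepFun (fun ω => R k z ω i) (fun ω => I k z ω i) P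
  /-- The regime of a type is drawn independently of its emigration variable. -/
  indep_R_D : ∀ k z i, IndepFun (fun ω => R k z ω i) (fun ω => D k z ω i) P
  identDistrib_X : ∀ k j i, IdentDistrib (X k j i) (X 0 0 i) P P
  identDistrib_I : ∀ k z, IdentDistrib (I k z) (I 0 z) P P
  identDistrib_D : ∀ k z, IdentDistrib (D k z) (D 0 z) P P
  identDistrib_M : ∀ k z, IdentDistrib
    (fun ω i => migrants (R k z ω i) (I k z ω i) (D k z ω i))
    (fun ω i => migrants (R 0 z ω i) (I 0 z ω i) (D 0 z ω i)) P P
  /-- `Z_0`, all the `X_{k,j,i}` and all the `M_k(z)` are independent. -/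
  indep : iIndepFun
    (source Z0 X (fun k z ω i => migrants (R k z ω i) (I k z ω i) (D k z ω i))) P

/-- A composition of the population, as a real vector. -/
def toReal {p : ℕ} (z : Fin p → ℕ) : Fin p → ℝ := fun i => (z i : ℝ)

/-- The filter `‖z‖ → ∞` on compositions. -/
def normAtTop (p : ℕ) : Filter (Fin p → ℕ) := comap (fun z => ‖toReal z‖) atTop

/-- The quotient `a / b` for `b ≥ 0`, with the value `+∞` if `b = 0` and `a > 0`
(and `-∞` if `b = 0` and `a ≤ 0`). -/
noncomputable def extQuotient (a b : ℝ) : EReal :=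
  if b = 0 then (if 0 < a then ⊤ else ⊥) else ((a / b : ℝ) : EReal)

namespace MBPM

variable {Ω : Type*} [MeasurableSpace Ω] {P : Measure Ω} {p : ℕ} (S : MBPM P p)

/-- The migration vector `M_k(z)`. -/
def M (k : ℕ) (z : Fin p → ℕ) (ω : Ω) (i : Fin p) : ℤ :=
  migrants (S.R k z ω i) (S.I k z ω i) (S.D k z ω i)

/-- The generation following generation `k`, if generation `k` has composition `z`:
`∑_i ∑_{j ≤ z_i + M_{k,i}(z)} X_{k,j,i}`. -/
def step (k : ℕ) (z : Fin p → ℕ) (ω : Ω) : Fin p → ℕ :=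
  ∑ i, ∑ j ∈ Finset.range ((z i : ℤ) + S.M k z ω i).toNat, S.X k j i ω

/-- The process `Z_k`. -/
def Z : ℕ → Ω → Fin p → ℕ
  | 0 => S.Z0
  | k + 1 => fun ω => S.step k (Z k ω) ω

/-- The offspring mean matrix; its `i`-th column is the mean of `X_{0,1,i}`. -/
noncomputable def meanMatrix : Matrix (Fin p) (Fin p) ℝ :=
  Matrix.of fun l i => ∫ ω, (S.X 0 0 i ω l : ℝ) ∂P

/-- The mean migration `h(z) = E[M_0(z)]`. -/
noncomputable def h (z : Fin p → ℕ) : Fin p → ℝ := fun i => ∫ ω, (S.M 0 z ω i : ℝ) ∂P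

/-- The standing moment assumptions: the offspring vectors have finite covariance matrices and
the migration vectors have finite means. -/
structure FiniteMoments : Prop where
  offspring : ∀ i l, MemLp (fun ω => (S.X 0 0 i ω l : ℝ)) 2 P
  migration : ∀ z i, Integrable (fun ω => (S.M 0 z ω i : ℝ)) P

/-- Criticality: the mean matrix is primitive and its Perron-Frobenius eigenvalue, that is, its
spectral radius, is 1. -/
structure Critical : Prop where
  primitive : S.meanMatrix.IsPrimitive
  spectralRadius_eq : spectralRadius ℂ (S.meanMatrix.map (fun x : ℝ => (x : ℂ))) = 1

/-- `u` is the left Perron-Frobenius eigenvector, with coordinates of sum 1. -/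
structure IsLeftPerron (u : Fin p → ℝ) : Prop where
  pos : ∀ i, 0 < u i
  sum_eq_one : ∑ i, u i = 1
  eigen : Matrix.vecMul u S.meanMatrix = u

/-- Mean migration is `o(‖z‖)`, in each coordinate. -/
def SmallMigration : Prop :=
  ∀ i, (fun z => S.h z i) =o[normAtTop p] (fun z => ‖toReal z‖)

/-- From each non-null `z` there is a positive probability that immigration occurs for all the
types which are present, and all the individuals of these types, immigrants included, have
children. -/
def GrowthPossible : Prop :=
  ∀ z : Fin p → ℕ, z ≠ 0 →
    0 < P {ω | ∀ i, 0 < z i →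
      S.M 0 z ω i = (S.I 0 z ω i : ℤ) ∧ 0 < S.I 0 z ω i ∧
        ∀ j < z i + S.I 0 z ω i, S.X 0 j i ω ≠ 0}

/-- `σ²(z)`, the variance of `uᵀ Z_{n+1}` given `Z_n = z`, that is, the variance of `uᵀ` applied
to the generation which follows the composition `z`. -/
noncomputable def sigmaSq (u : Fin p → ℝ) (z : Fin p → ℕ) : ℝ :=
  variance (fun ω => u ⬝ᵥ toReal (S.step 0 z ω)) P

/-- The comparison function of the two moment conditions:
`(uᵀz)^{1+δ} (uᵀh(z)) / (log uᵀz)^{1+α}`. -/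
noncomputable def momentScale (u : Fin p → ℝ) (δ α : ℝ) (z : Fin p → ℕ) : ℝ :=
  (u ⬝ᵥ toReal z) ^ (1 + δ) * (u ⬝ᵥ S.h z) / (Real.log (u ⬝ᵥ toReal z)) ^ (1 + α)

end MBPM

end Migration

namespace Migration

/-! The proof is a Lyapunov argument for the weight `x = uᵀz` and `L(y) = log(e + y)^(-α)`, which
decreases to `0`. Since `u` is a left eigenvector for the eigenvalue `1`, reproduction preserves the
mean weight, so the weight `Y` of the next generation has mean `x + g` with `g = uᵀh(z)`. Put `D =
-L'(x)`; then `L''(x)` is close to `D / x`, and a Taylor expansion bounds `E L(Y) - L(x)` by `-D g`,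
plus about `D (σ² + g²) / (2x)`, plus a remainder. The liminf condition makes the variance term at
most a fraction `1/c < 1` of `D g`, and `g² = o(x g)` because migration is small.

The remainder concerns only large downward jumps: `L''` is decreasing, so the expansion is harmless
upwards. As `L ≤ 1`, it is at most a constant times `E[((x - Y)⁺)^(2+δ)] / x^(2+δ)`. Offspring has
only two moments, but lower deviations of sums of nonnegative variables are sub-Gaussian, so a sum
of `N` terms contributes `O(E[N^(1+δ/2)])`; the fluctuations of migration contribute their moments
of order `2 + δ`. The two moment conditions make all this `o(g / (x (log x)^(1+α)))`, which is `o(D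
g)`: this is why `L` is a power of the logarithm. Hence `E L(Y) ≤ L(x)` for large `x`
(`exists_integral_lyapunov_le`, `exists_integral_lyapunov_step_le`).

Truncated at its value `c` at the threshold, `L(uᵀZ_n)` is a bounded supermartingale and converges
almost surely. Limit `0` means that the process tends to infinity. A limit strictly between `0` and
`c` would confine it to finitely many non-null compositions, which `measure_trapped_eq_zero`
excludes. If divergence had probability zero, the limit would be `c` almost surely; but the means
are nonincreasing, and below `c` once the weight exceeds the threshold with positive probability
(`exists_measure_large_pos`). This is the contradiction in `measure_tendsto_pos`. -/

instance : DiscreteMeasurableSpace Regime := ⟨fun _ => trivial⟩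

instance : Countable Regime :=
  Function.Injective.countable (f := fun r : Regime => match r with
    | .none => (0 : ℕ) | .immigration => 1 | .emigration => 2)
    (by rintro (_ | _ | _) (_ | _ | _) h <;> simp_all)

/-! ### Sources of randomness, time homogeneity and the Markov property. -/

/-- The generation produced by a source of randomness. -/
def Source.time {p : ℕ} : Source p → ℕ
  | .initial => 0
  | .offspring k _ _ => k + 1
  | .migration k _ => k + 1

/-- The sources involved in the transition from generation `k`, of composition `z`. -/
def Source.transition {p : ℕ} (k : ℕ) (z : Fin p → ℕ) : Option (ℕ × Fin p) → Source p
  | none => .migration k z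
  | some (j, i) => .offspring k j i

lemma Source.transition_injective {p : ℕ} (k : ℕ) (z : Fin p → ℕ) :
    Function.Injective (Source.transition k z) := by
  rintro (_ | ⟨j, i⟩) (_ | ⟨j', i'⟩) h <;> simp_all [Source.transition]

/-- The next generation as a function of the migration and offspring vectors. -/
def nextGeneration {p : ℕ} (z : Fin p → ℕ) (a : Option (ℕ × Fin p) → Fin p → ℤ) : Fin p → ℕ :=
  ∑ i, ∑ j ∈ Finset.range ((z i : ℤ) + a none i).toNat, fun l => (a (some (j, i)) l).toNat

lemma measurable_apply_of_countable {Ω β γ : Type*} {m : MeasurableSpace Ω} [MeasurableSpace β]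
    [MeasurableSpace γ] [Countable β] [MeasurableSingletonClass β] {F : β → Ω → γ} {N : Ω → β}
    (hF : ∀ b, Measurable (F b)) (hN : Measurable N) : Measurable fun ω => F (N ω) ω :=
  (measurable_from_prod_countable_left (f := fun q : Ω × β => F q.2 q.1) hF).comp
    (measurable_id.prodMk hN)

lemma measurable_indicator_one {Ω : Type*} {m : MeasurableSpace Ω} {A : Set Ω}
    (hA : MeasurableSet A) : Measurable (A.indicator (1 : Ω → ENNReal)) :=
  measurable_one.indicator hA

lemma measurable_sum_range {β γ : Type*} [MeasurableSpace β] [MeasurableSpace γ]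
    [AddCommMonoid γ] [MeasurableAdd₂ γ] {N : β → ℕ} (hN : Measurable N) {F : ℕ → β → γ}
    (hF : ∀ j, Measurable (F j)) : Measurable fun b => ∑ j ∈ Finset.range (N b), F j b :=
  measurable_apply_of_countable (F := fun n b => ∑ j ∈ Finset.range n, F j b)
    (fun n => Finset.measurable_fun_sum (Finset.range n) fun j _ => hF j) hN

lemma measurable_nextGeneration {p : ℕ} (z : Fin p → ℕ) : Measurable (nextGeneration z) := by
  unfold nextGeneration
  refine Finset.measurable_fun_sum _ fun i _ => measurable_sum_range ?_ fun j => ?_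
  · have : Measurable fun x : ℤ => ((z i : ℤ) + x).toNat := Measurable.of_discrete
    exact this.comp ((measurable_pi_apply i).comp (measurable_pi_apply _))
  · refine measurable_pi_lambda _ fun l => ?_
    have : Measurable fun x : ℤ => x.toNat := Measurable.of_discrete
    exact this.comp ((measurable_pi_apply l).comp (measurable_pi_apply _))

namespace MBPM

variable {Ω : Type*} [MeasurableSpace Ω] {P : Measure Ω} {p : ℕ} (S : MBPM P p)

/-- The independent family of the process. -/
def family : Source p → Ω → Fin p → ℤ := source S.Z0 S.X S.M

lemma iIndepFun_family : iIndepFun S.family P := S.indep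

lemma measurable_M (k : ℕ) (z : Fin p → ℕ) : Measurable (S.M k z) := by
  refine measurable_pi_lambda _ fun i => ?_
  have h : Measurable fun q : Regime × ℕ × ℕ => migrants q.1 q.2.1 q.2.2 := Measurable.of_discrete
  exact h.comp (((measurable_pi_apply i).comp (S.measurable_R k z)).prodMk
    (((measurable_pi_apply i).comp (S.measurable_I k z)).prodMk
      ((measurable_pi_apply i).comp (S.measurable_D k z))))

lemma measurable_family (s : Source p) : Measurable (S.family s) := by
  have hc : Measurable fun (y : Fin p → ℕ) (l : Fin p) => (y l : ℤ) :=
    measurable_pi_lambda _ fun l =>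
      (Measurable.of_discrete : Measurable fun n : ℕ => (n : ℤ)).comp (measurable_pi_apply l)
  cases s with
  | initial => exact hc.comp S.measurable_Z0
  | offspring k j i => exact hc.comp (S.measurable_X k j i)
  | migration k z => exact S.measurable_M k z

/-- The family of sources of the transition from generation `k`, of composition `z`. -/
def transitionFamily (k : ℕ) (z : Fin p → ℕ) (ω : Ω) (s : Option (ℕ × Fin p)) : Fin p → ℤ :=
  S.family (Source.transition k z s) ω

lemma step_eq_nextGeneration (k : ℕ) (z : Fin p → ℕ) (ω : Ω) :
    S.step k z ω = nextGeneration z (S.transitionFamily k z ω) := by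
  have h (j : ℕ) (i : Fin p) :
      (fun l => (S.transitionFamily k z ω (some (j, i)) l).toNat) = S.X k j i ω := by
    funext l
    exact Int.toNat_natCast _
  unfold step nextGeneration
  refine Finset.sum_congr rfl fun i _ => ?_
  exact Finset.sum_congr rfl fun j _ => (h j i).symm

lemma step_eq_comp (k : ℕ) (z : Fin p → ℕ) :
    S.step k z = nextGeneration z ∘ S.transitionFamily k z :=
  funext (S.step_eq_nextGeneration k z)

lemma measurable_transitionFamily (k : ℕ) (z : Fin p → ℕ) :
    Measurable (S.transitionFamily k z) :=
  measurable_pi_lambda _ fun _ => S.measurable_family _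

lemma measurable_step (k : ℕ) (z : Fin p → ℕ) : Measurable (S.step k z) := by
  rw [S.step_eq_comp]
  exact (measurable_nextGeneration z).comp (S.measurable_transitionFamily k z)

lemma identDistrib_transition [IsProbabilityMeasure P] (k : ℕ) (z : Fin p → ℕ)
    (s : Option (ℕ × Fin p)) :
    P.map (S.family (Source.transition k z s)) = P.map (S.family (Source.transition 0 z s)) := by
  rcases s with _ | ⟨j, i⟩
  · exact (S.identDistrib_M k z).map_eq
  · have hc : Measurable fun (y : Fin p → ℕ) (l : Fin p) => (y l : ℤ) :=
      measurable_pi_lambda _ fun l =>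
        (Measurable.of_discrete : Measurable fun n : ℕ => (n : ℤ)).comp (measurable_pi_apply l)
    exact (((S.identDistrib_X k j i).trans (S.identDistrib_X 0 j i).symm).comp hc).map_eq

/-- By independence, the joint law of the sources of a transition is the product of their laws,
which do not depend on `k`; the next generation is a fixed measurable function of them. All later
estimates can therefore be made on `step 0`. -/
lemma identDistrib_step [IsProbabilityMeasure P] (k : ℕ) (z : Fin p → ℕ) :
    IdentDistrib (S.step k z) (S.step 0 z) P P := by
  have h (k : ℕ) : P.map (S.transitionFamily k z) =
      Measure.infinitePi fun s => P.map (S.family (Source.transition k z s)) :=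
    (iIndepFun_iff_map_fun_eq_infinitePi_map fun s => S.measurable_family _).1
      (S.iIndepFun_family.precomp (Source.transition_injective k z))
  have h' : IdentDistrib (S.transitionFamily k z) (S.transitionFamily 0 z) P P :=
    ⟨(S.measurable_transitionFamily k z).aemeasurable,
      (S.measurable_transitionFamily 0 z).aemeasurable, by
        rw [h k, h 0]; congr 1; funext s; exact S.identDistrib_transition k z s⟩
  rw [S.step_eq_comp, S.step_eq_comp]
  exact h'.comp (measurable_nextGeneration z)

/-- The σ-algebra generated by the sources of the generations up to `n`. -/
def past : Filtration ℕ (inferInstance : MeasurableSpace Ω) where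
  seq n := ⨆ s ∈ {s : Source p | s.time ≤ n}, MeasurableSpace.comap (S.family s) inferInstance
  mono' _ _ hmn := biSup_mono fun _ hs => le_trans hs hmn
  le' _ := iSup₂_le fun s _ => (S.measurable_family s).comap_le

/-- The σ-algebra generated by the sources of the transition from generation `n`. -/
@[reducible] def innovation (n : ℕ) : MeasurableSpace Ω :=
  ⨆ s ∈ {s : Source p | s.time = n + 1}, MeasurableSpace.comap (S.family s) inferInstance

lemma innovation_le (n : ℕ) : S.innovation n ≤ (inferInstance : MeasurableSpace Ω) :=
  iSup₂_le fun s _ => (S.measurable_family s).comap_le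

lemma innovation_le_past (n : ℕ) : S.innovation n ≤ S.past (n + 1) :=
  biSup_mono fun _ hs => le_of_eq hs

lemma indep_past_innovation (n : ℕ) : Indep (S.past n) (S.innovation n) P :=
  indep_iSup_of_disjoint (fun s => (S.measurable_family s).comap_le) S.iIndepFun_family
    (Set.disjoint_left.2 fun s (h : s.time ≤ n) (h' : s.time = n + 1) => by omega)

lemma measurable_step_innovation (n : ℕ) (z : Fin p → ℕ) :
    Measurable[S.innovation n] (S.step n z) := by
  rw [S.step_eq_comp]
  refine (measurable_nextGeneration z).comp
    (@measurable_pi_lambda _ _ _ (S.innovation n) _ (S.transitionFamily n z) fun s => ?_)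
  refine measurable_iff_comap_le.2 (le_iSup₂_of_le (Source.transition n z s) ?_ le_rfl)
  rcases s with _ | ⟨j, i⟩ <;> rfl

lemma measurable_Z (n : ℕ) : Measurable[S.past n] (S.Z n) := by
  induction n with
  | zero =>
    have h : Measurable[S.past 0] (S.family .initial) :=
      measurable_iff_comap_le.2 (le_iSup₂_of_le (Source.initial) (le_refl 0) le_rfl)
    have hc : Measurable fun (y : Fin p → ℤ) (l : Fin p) => (y l).toNat :=
      measurable_pi_lambda _ fun l =>
        (Measurable.of_discrete : Measurable fun n : ℤ => n.toNat).comp (measurable_pi_apply l)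
    have e : S.Z 0 = (fun (y : Fin p → ℤ) (l : Fin p) => (y l).toNat) ∘ S.family .initial := by
      funext ω l
      exact (Int.toNat_natCast _).symm
    rw [e]
    exact hc.comp h
  | succ n ih =>
    exact measurable_apply_of_countable (m := S.past (n + 1)) (F := fun z => S.step n z)
      (N := S.Z n)
      (fun z => (S.measurable_step_innovation n z).mono (S.innovation_le_past n) le_rfl)
      (ih.mono (S.past.mono n.le_succ) le_rfl)

lemma measurable_Z_ambient (n : ℕ) : Measurable (S.Z n) := (S.measurable_Z n).mono (S.past.le n) le_rfl

/-- The Markov property. -/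
lemma setLIntegral_Z_succ [IsProbabilityMeasure P] (n : ℕ) {A : Set Ω}
    (hA : MeasurableSet[S.past n] A) (φ : (Fin p → ℕ) → ENNReal) :
    ∫⁻ ω in A, φ (S.Z (n + 1) ω) ∂P = ∫⁻ ω in A, (∫⁻ ω', φ (S.step 0 (S.Z n ω) ω') ∂P) ∂P := by
  have hφ : Measurable φ := Measurable.of_discrete
  have hAm : MeasurableSet A := S.past.le n _ hA
  have hset (z : Fin p → ℕ) : MeasurableSet[S.past n] (A ∩ S.Z n ⁻¹' {z}) :=
    hA.inter (S.measurable_Z n (measurableSet_singleton z))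
  -- Once the value `z` of `Z n` is fixed, the next generation is `step n z`, a function of the
  -- innovation, which is independent of the past event.
  have key (z : Fin p → ℕ) : ∫⁻ ω in A ∩ S.Z n ⁻¹' {z}, φ (S.Z (n + 1) ω) ∂P =
      ∫⁻ ω in A ∩ S.Z n ⁻¹' {z}, (∫⁻ ω', φ (S.step 0 (S.Z n ω) ω') ∂P) ∂P := by
    have hm : MeasurableSet (A ∩ S.Z n ⁻¹' {z}) := S.past.le n _ (hset z)
    have e1 : ∫⁻ ω in A ∩ S.Z n ⁻¹' {z}, φ (S.Z (n + 1) ω) ∂P =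
        ∫⁻ ω, (A ∩ S.Z n ⁻¹' {z}).indicator 1 ω * φ (S.step n z ω) ∂P := by
      rw [← lintegral_indicator hm]
      refine lintegral_congr fun ω => ?_
      by_cases h : ω ∈ A ∩ S.Z n ⁻¹' {z}
      · have hz : S.Z n ω = z := h.2
        simp [Set.indicator_of_mem h, Z, hz]
      · simp [Set.indicator_of_notMem h]
    have hind : Measurable[S.past n] ((A ∩ S.Z n ⁻¹' {z}).indicator (1 : Ω → ENNReal)) :=
      measurable_indicator_one (hset z)
    have hid : ∫⁻ ω, φ (S.step n z ω) ∂P = ∫⁻ ω, φ (S.step 0 z ω) ∂P :=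
      ((S.identDistrib_step n z).comp hφ).lintegral_eq
    rw [e1, lintegral_mul_eq_lintegral_mul_lintegral_of_independent_measurableSpace
      (S.past.le n) (S.innovation_le n) (S.indep_past_innovation n)
      (h_meas_g := hφ.comp (S.measurable_step_innovation n z))
      (f := (A ∩ S.Z n ⁻¹' {z}).indicator 1) (g := fun ω => φ (S.step n z ω)) hind,
      lintegral_indicator_one hm,
      hid,
      setLIntegral_congr_fun (g := fun _ => ∫⁻ ω', φ (S.step 0 z ω') ∂P) hm, setLIntegral_const,
      mul_comm]
    · intro ω hω
      have hz : S.Z n ω = z := hω.2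
      simp [hz]
  have hU : A = ⋃ z, A ∩ S.Z n ⁻¹' {z} := by ext; simp
  have hd : Pairwise (Function.onFun Disjoint fun z => A ∩ S.Z n ⁻¹' {z}) := fun z z' hz =>
    Set.disjoint_left.2 fun ω h h' => hz (h.2.symm.trans h'.2)
  rw [hU, lintegral_iUnion (fun z => S.past.le n _ (hset z)) hd,
    lintegral_iUnion (fun z => S.past.le n _ (hset z)) hd]
  exact tsum_congr key

/-! ### Escape from bounded sets of compositions. -/

variable {S} in
-- On the growth event each type present gains an immigrant, and every reproducing individual of
-- that type has a child: type `i` alone then yields more than `z i` children.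
lemma GrowthPossible.measure_increase_pos (hg : S.GrowthPossible) {z : Fin p → ℕ} (hz : z ≠ 0) :
    0 < P {ω | ∑ i, z i < ∑ i, S.step 0 z ω i} := by
  refine (hg z hz).trans_le (measure_mono fun ω hω => ?_)
  have hstep : ∑ l, S.step 0 z ω l =
      ∑ i, ∑ j ∈ Finset.range ((z i : ℤ) + S.M 0 z ω i).toNat, ∑ l, S.X 0 j i ω l := by
    simp only [step, Finset.sum_apply]
    rw [Finset.sum_comm]
    exact Finset.sum_congr rfl fun i _ => Finset.sum_comm
  have hlt (i : Fin p) (hi : 0 < z i) : z i <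
      ∑ j ∈ Finset.range ((z i : ℤ) + S.M 0 z ω i).toNat, ∑ l, S.X 0 j i ω l := by
    obtain ⟨h1, h2, h3⟩ := hω i hi
    have hN : ((z i : ℤ) + S.M 0 z ω i).toNat = z i + S.I 0 z ω i := by omega
    rw [hN]
    have : ∀ j ∈ Finset.range (z i + S.I 0 z ω i), 1 ≤ ∑ l, S.X 0 j i ω l := fun j hj => by
      by_contra hc
      refine h3 j (Finset.mem_range.1 hj) (funext fun l => ?_)
      have h0 : ∑ l, S.X 0 j i ω l = 0 := by omega
      exact Finset.sum_eq_zero_iff.1 h0 l (Finset.mem_univ l)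
    have := Finset.card_nsmul_le_sum _ _ 1 this
    simp at this
    omega
  obtain ⟨i, hi⟩ : ∃ i, z i ≠ 0 := Function.ne_iff.1 hz
  change ∑ i, z i < ∑ i, S.step 0 z ω i
  rw [hstep]
  refine Finset.sum_lt_sum (fun i _ => ?_) ⟨i, Finset.mem_univ i, hlt i (Nat.pos_of_ne_zero hi)⟩
  rcases Nat.eq_zero_or_pos (z i) with h | h
  · omega
  · exact (hlt i h).le

lemma finite_setOf_sum_le (p K : ℕ) : {z : Fin p → ℕ | ∑ i, z i ≤ K}.Finite :=
  (Set.finite_Iic fun _ : Fin p => K).subset fun _ hz i =>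
    (Finset.single_le_sum (fun _ _ => Nat.zero_le _) (Finset.mem_univ i)).trans hz

/-- A function which contracts under the transition from the bounded non-null compositions. -/
lemma exists_contracting [IsProbabilityMeasure P] (hg : S.GrowthPossible) (K : ℕ) :
    ∃ (w : (Fin p → ℕ) → ENNReal) (θ c : ENNReal), θ < 1 ∧ c ≠ 0 ∧ (∀ z, w z ≤ 1) ∧
      ∀ z, z ≠ 0 → ∑ i, z i ≤ K → c ≤ w z ∧ ∫⁻ ω, w (S.step 0 z ω) ∂P ≤ θ * w z := by
  let F := {z : Fin p → ℕ | z ≠ 0 ∧ ∑ i, z i ≤ K}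
  have hF : F.Finite := (finite_setOf_sum_le p K).subset fun z hz => hz.2
  -- Finitely many compositions are involved, so their probabilities of growth have a common lower
  -- bound `η > 0`.
  have hev : ∀ᶠ η in nhdsWithin (0 : ℝ) (Set.Ioi 0),
      ∀ z ∈ F, η ≤ P.real {ω | ∑ i, z i < ∑ i, S.step 0 z ω i} := by
    rw [hF.eventually_all]
    intro z hz
    exact (eventually_le_nhds ((ENNReal.toReal_pos
      (hg.measure_increase_pos hz.1).ne' (measure_ne_top _ _)))).filter_mono nhdsWithin_le_nhds
  have hev1 : ∀ᶠ η in nhdsWithin (0 : ℝ) (Set.Ioi 0), η ≤ 1 :=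
    (eventually_le_nhds one_pos).filter_mono nhdsWithin_le_nhds
  obtain ⟨η, hη, hη1, hη0⟩ := (hev.and (hev1.and self_mem_nhdsWithin)).exists
  replace hη0 : 0 < η := hη0
  let β := η / 2
  have hβ0 : 0 < β := half_pos hη0
  have hβ1 : β < 1 := by simp only [β]; linarith
  have hpow (n : ℕ) : 0 < β ^ n ∧ β ^ n ≤ 1 := ⟨pow_pos hβ0 n, pow_le_one₀ hβ0.le hβ1.le⟩
  let θ : ℝ := 1 - β * β ^ K
  have hθ0 : 0 ≤ θ := by
    -- The witness is `w = 1 - β^(K+1-s)`, `s` being the total size. Truncated subtraction makes it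
    -- vanish for `s > K`. With `t = β^(K-s)`, growth of probability at least `η = 2β` brings its
    -- mean down to at most `1 - 2βt`, which is below `θ (1 - βt)` because `β^K ≤ t`.
    simp only [θ]; nlinarith [hpow K]
  refine ⟨fun z => ENNReal.ofReal (1 - β ^ (K + 1 - ∑ i, z i)), ENNReal.ofReal θ,
    ENNReal.ofReal (1 - β), ?_, ?_, ?_, ?_⟩
  · rw [ENNReal.ofReal_lt_one]
    have := mul_pos hβ0 (hpow K).1
    simp only [θ]; linarith
  · simpa using hβ1
  · intro z
    rw [ENNReal.ofReal_le_one]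
    linarith [(hpow (K + 1 - ∑ i, z i)).1]
  · intro z hz hzK
    set s := ∑ i, z i
    have hs : K + 1 - s = (K - s) + 1 := by omega
    let t := β ^ (K - s)
    have ht : β ^ (K + 1 - s) = β * t := by rw [hs, pow_succ, mul_comm]
    obtain ⟨ht0, ht1⟩ : 0 < t ∧ t ≤ 1 := hpow (K - s)
    have htK : β ^ K ≤ t := pow_le_pow_of_le_one hβ0.le hβ1.le (Nat.sub_le _ _)
    refine ⟨ENNReal.ofReal_le_ofReal ?_, ?_⟩
    · rw [ht]; nlinarith
    let A := {ω | s < ∑ i, S.step 0 z ω i}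
    have hA : MeasurableSet A := by
      have : Measurable fun y : Fin p → ℕ => ∑ i, y i := Measurable.of_discrete
      exact (this.comp (S.measurable_step 0 z)) (measurableSet_Ioi (a := s))
    have hpt (ω : Ω) : ENNReal.ofReal (1 - β ^ (K + 1 - ∑ i, S.step 0 z ω i)) ≤
        A.indicator (fun _ => ENNReal.ofReal (1 - t)) ω + Aᶜ.indicator (fun _ => 1) ω := by
      by_cases h : ω ∈ A
      · rw [Set.indicator_of_mem h, Set.indicator_of_notMem (by simpa using h), add_zero]
        have h' : s < ∑ i, S.step 0 z ω i := h
        exact ENNReal.ofReal_le_ofReal (sub_le_sub_left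
          (pow_le_pow_of_le_one hβ0.le hβ1.le (by omega)) 1)
      · rw [Set.indicator_of_notMem h, Set.indicator_of_mem (by simpa using h), zero_add,
          ENNReal.ofReal_le_one]
        linarith [(hpow (K + 1 - ∑ i, S.step 0 z ω i)).1]
    refine (lintegral_mono hpt).trans ?_
    rw [lintegral_add_left (measurable_const.indicator hA), lintegral_indicator_const hA,
      lintegral_indicator_const hA.compl, one_mul, ← ofReal_measureReal, ← ofReal_measureReal,
      ← ENNReal.ofReal_mul (by linarith), ← ENNReal.ofReal_add (by
        have := measureReal_nonneg (μ := P) (s := A); nlinarith) measureReal_nonneg,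
      ← ENNReal.ofReal_mul hθ0, probReal_compl_eq_one_sub hA]
    refine ENNReal.ofReal_le_ofReal ?_
    have hηA : η ≤ P.real A := hη z ⟨hz, hzK⟩
    rw [ht]
    have h2 : η = 2 * β := by simp only [β]; ring
    simp only [θ]
    nlinarith [mul_le_mul_of_nonneg_left hηA ht0.le, mul_le_mul_of_nonneg_left htK hβ0.le,
      mul_nonneg (mul_nonneg hβ0.le (hpow K).1.le) (mul_nonneg hβ0.le ht0.le)]

/-- The process does not stay forever among the non-null compositions of bounded size. -/
lemma measure_trapped_eq_zero [IsProbabilityMeasure P] (hg : S.GrowthPossible) (N K : ℕ) :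
    P {ω | ∀ n ≥ N, S.Z n ω ≠ 0 ∧ ∑ i, S.Z n ω i ≤ K} = 0 := by
  obtain ⟨w, θ, c, hθ, hc, hw1, hw⟩ := S.exists_contracting hg K
  let F := {z : Fin p → ℕ | z ≠ 0 ∧ ∑ i, z i ≤ K}
  let A (m : ℕ) : Set Ω := ⋂ k ∈ Finset.range (m + 1), S.Z (N + k) ⁻¹' F
  have hA (m : ℕ) : MeasurableSet[S.past (N + m)] (A m) :=
    Finset.measurableSet_biInter _ fun k hk => ((S.measurable_Z (N + k)).mono
      (S.past.mono (by have := Finset.mem_range.1 hk; omega)) le_rfl) (Set.to_countable F).measurableSet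
  have hAF (m : ℕ) {ω : Ω} (h : ω ∈ A m) : S.Z (N + m) ω ∈ F :=
    Set.mem_iInter₂.1 h m (by simp)
  -- Each further step in the trap costs a factor `θ`, by the Markov property. As `w ≥ c` there, the
  -- probability of `m` steps is at most `θ ^ m / c`.
  have hbound (m : ℕ) : ∫⁻ ω in A m, w (S.Z (N + m) ω) ∂P ≤ θ ^ m := by
    induction m with
    | zero =>
      refine (lintegral_mono fun ω => hw1 _).trans ?_
      simpa using prob_le_one
    | succ m ih =>
      have hsub : A (m + 1) ⊆ A m := Set.biInter_subset_biInter_left fun k hk => by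
        simp only [Finset.coe_range, Set.mem_Iio] at hk ⊢
        omega
      calc ∫⁻ ω in A (m + 1), w (S.Z (N + m + 1) ω) ∂P
          ≤ ∫⁻ ω in A m, w (S.Z (N + m + 1) ω) ∂P := lintegral_mono_set hsub
        _ = ∫⁻ ω in A m, (∫⁻ ω', w (S.step 0 (S.Z (N + m) ω) ω') ∂P) ∂P :=
          S.setLIntegral_Z_succ _ (hA m) w
        _ ≤ ∫⁻ ω in A m, θ * w (S.Z (N + m) ω) ∂P :=
          setLIntegral_mono' (S.past.le _ _ (hA m)) fun ω hω =>
            (hw _ (hAF m hω).1 (hAF m hω).2).2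
        _ = θ * ∫⁻ ω in A m, w (S.Z (N + m) ω) ∂P :=
          lintegral_const_mul _ ((Measurable.of_discrete (f := w)).comp (S.measurable_Z_ambient _))
        _ ≤ θ ^ (m + 1) := by rw [pow_succ, mul_comm]; gcongr
  have hle (m : ℕ) : c * P {ω | ∀ n ≥ N, S.Z n ω ≠ 0 ∧ ∑ i, S.Z n ω i ≤ K} ≤ θ ^ m := by
    calc c * P {ω | ∀ n ≥ N, S.Z n ω ≠ 0 ∧ ∑ i, S.Z n ω i ≤ K}
        ≤ c * P (A m) := by
          gcongr
          exact fun ω hω => Set.mem_iInter₂.2 fun k _ => hω (N + k) (by omega)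
      _ = ∫⁻ _ in A m, c ∂P := by rw [setLIntegral_const]
      _ ≤ ∫⁻ ω in A m, w (S.Z (N + m) ω) ∂P :=
          setLIntegral_mono' (S.past.le _ _ (hA m)) fun ω hω =>
            (hw _ (hAF m hω).1 (hAF m hω).2).1
      _ ≤ θ ^ m := hbound m
  have h0 := ge_of_tendsto' (ENNReal.tendsto_pow_atTop_nhds_zero_of_lt_one hθ) hle
  simpa [hc] using h0

lemma exists_measure_large_pos [IsProbabilityMeasure P] (hg : S.GrowthPossible)
    (hnonnull : 0 < P {ω | ∃ n, S.Z n ω ≠ 0}) (K : ℕ) :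
    ∃ n, 0 < P {ω | K ≤ ∑ i, S.Z n ω i} := by
  -- The bound `K + 1` makes the compositions of the induction hypothesis non-null, so that growth
  -- applies to them.
  suffices h : ∃ n, 0 < P {ω | K + 1 ≤ ∑ i, S.Z n ω i} by
    obtain ⟨n, hn⟩ := h
    exact ⟨n, hn.trans_le (measure_mono fun ω (h : K + 1 ≤ _) =>
      show K ≤ ∑ i, S.Z n ω i by omega)⟩
  induction K with
  | zero =>
    by_contra! hc
    refine hnonnull.ne' (measure_mono_null (t := ⋃ n, {ω | 0 + 1 ≤ ∑ i, S.Z n ω i}) ?_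
      (measure_iUnion_null fun n => le_zero_iff.1 (hc n)))
    rintro ω ⟨n, hn⟩
    obtain ⟨i, hi⟩ := Function.ne_iff.1 hn
    refine Set.mem_iUnion.2 ⟨n, ?_⟩
    have := Finset.single_le_sum (f := S.Z n ω) (fun _ _ => Nat.zero_le _) (Finset.mem_univ i)
    simp only [Pi.zero_apply] at hi
    change 0 + 1 ≤ ∑ i, S.Z n ω i
    omega
  | succ K ih =>
    obtain ⟨n, hn⟩ := ih
    refine ⟨n + 1, ?_⟩
    let B (k n : ℕ) := {ω | k ≤ ∑ i, S.Z n ω i}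
    have hm : Measurable fun y : Fin p → ℕ => ∑ i, y i := Measurable.of_discrete
    have hB (k n : ℕ) : MeasurableSet[S.past n] (B k n) :=
      (hm.comp (S.measurable_Z n)) (measurableSet_Ici (a := k))
    let φ : (Fin p → ℕ) → ENNReal := {z | K + 2 ≤ ∑ i, z i}.indicator 1
    have hφ (ω : Ω) : φ (S.Z (n + 1) ω) = (B (K + 2) (n + 1)).indicator 1 ω := rfl
    have h1 : ∫⁻ ω in B (K + 1) n, φ (S.Z (n + 1) ω) ∂P ≤ P (B (K + 2) (n + 1)) := by
      simp_rw [hφ]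
      refine (setLIntegral_le_lintegral _ _).trans ?_
      rw [lintegral_indicator_one (S.past.le _ _ (hB _ _))]
    refine lt_of_lt_of_le ?_ h1
    rw [S.setLIntegral_Z_succ n (hB _ _), pos_iff_ne_zero]
    intro h0
    replace h0 := (setLIntegral_eq_zero_iff (S.past.le _ _ (hB (K + 1) n))
      ((Measurable.of_discrete (f := fun z => ∫⁻ ω', φ (S.step 0 z ω') ∂P)).comp
        (S.measurable_Z_ambient n))).1 h0
    refine hn.ne' (measure_mono_null (fun ω hω => ?_) h0)
    intro hcon
    have hω' : K + 1 ≤ ∑ i, S.Z n ω i := hω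
    have hz : S.Z n ω ≠ 0 := fun h => by simp [h] at hω'
    have hpos := hg.measure_increase_pos hz
    have h2 := hcon hω
    let C := {ω' | ∑ i, S.Z n ω i < ∑ i, S.step 0 (S.Z n ω) ω' i}
    have hms : MeasurableSet C :=
      (hm.comp (S.measurable_step 0 _)) (measurableSet_Ioi (a := ∑ i, S.Z n ω i))
    change 0 < P C at hpos
    rw [← lintegral_indicator_one hms] at hpos
    refine (hpos.trans_le (lintegral_mono fun ω' => ?_)).ne' h2
    by_cases h : ω' ∈ C
    · have h' : S.step 0 (S.Z n ω) ω' ∈ {z : Fin p → ℕ | K + 2 ≤ ∑ i, z i} := by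
        change K + 2 ≤ ∑ i, S.step 0 (S.Z n ω) ω' i
        have : ∑ i, S.Z n ω i < ∑ i, S.step 0 (S.Z n ω) ω' i := h
        omega
      simp only [φ]
      rw [Set.indicator_of_mem h', Set.indicator_of_mem h]
      exact le_rfl
    · rw [Set.indicator_of_notMem h]
      exact bot_le

end MBPM
end Migration

/-! ### Lower deviations of random sums with two moments. -/

namespace Migration

section Auxiliary

variable {Ω : Type*} [MeasurableSpace Ω] {P : Measure Ω}

/-- Follows from `(1 + x + x²/2)(1 - x + x²/2) = 1 + x⁴/4 ≥ 1`. It bounds the Laplace transform of a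
nonnegative variable by its first two moments. -/
lemma exp_neg_le_quadratic {x : ℝ} (hx : 0 ≤ x) : Real.exp (-x) ≤ 1 - x + x ^ 2 / 2 := by
  have h := Real.quadratic_le_exp_of_nonneg hx
  have hpos : 0 < 1 + x + x ^ 2 / 2 := by positivity
  rw [Real.exp_neg]
  refine (inv_anti₀ hpos h).trans ?_
  rw [inv_le_iff_one_le_mul₀ hpos]
  nlinarith [sq_nonneg (x ^ 2)]

lemma rpow_le_exp {t q : ℝ} (ht : 0 ≤ t) (hq0 : 0 ≤ q) (hq : q ≤ 3) :
    t ^ q ≤ 7 * Real.exp t := by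
  have h1 : 1 ≤ Real.exp t := Real.one_le_exp ht
  rcases le_total t 1 with h | h
  · exact (Real.rpow_le_one ht h hq0).trans (by linarith)
  · have h2 : t ^ q ≤ t ^ ((3 : ℕ) : ℝ) :=
      Real.rpow_le_rpow_of_exponent_le h (by exact_mod_cast hq)
    have h3 := Real.pow_div_factorial_le_exp t ht 3
    rw [Real.rpow_natCast] at h2
    norm_num [Nat.factorial] at h3
    linarith

lemma integrable_and_integral_le {f : Ω → ℝ} (hf : AEStronglyMeasurable f P) (h0 : ∀ ω, 0 ≤ f ω)
    {B : ℝ} (hB : 0 ≤ B) (h : ∫⁻ ω, ENNReal.ofReal (f ω) ∂P ≤ ENNReal.ofReal B) :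
    Integrable f P ∧ ∫ ω, f ω ∂P ≤ B := by
  refine ⟨⟨hf, ?_⟩, ?_⟩
  · rw [hasFiniteIntegral_iff_ofReal (ae_of_all _ h0)]
    exact h.trans_lt ENNReal.ofReal_lt_top
  · rw [integral_eq_lintegral_of_nonneg_ae (ae_of_all _ h0) hf]
    exact ENNReal.toReal_le_of_le_ofReal hB h

lemma lintegral_of_indepFun [IsFiniteMeasure P] {α β : Type*} [MeasurableSpace α]
    [MeasurableSpace β] {f : Ω → α} {g : Ω → β} (hf : Measurable f) (hg : Measurable g)
    (h : IndepFun f g P) {φ : α × β → ENNReal} (hφ : Measurable φ) :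
    ∫⁻ ω, φ (f ω, g ω) ∂P = ∫⁻ ω, ∫⁻ ω', φ (f ω, g ω') ∂P ∂P := by
  have h1 := (indepFun_iff_map_prod_eq_prod_map_map hf.aemeasurable hg.aemeasurable).1 h
  rw [← lintegral_map (f := φ) (g := fun ω => (f ω, g ω)) hφ (hf.prodMk hg), h1,
    lintegral_prod _ hφ.aemeasurable, lintegral_map (hφ.lintegral_prod_right') hf]
  refine lintegral_congr fun ω => ?_
  exact lintegral_map (hφ.comp measurable_prodMk_left) hg

end Auxiliary

/-- A random number `N` of terms, independent of the sequence `ξ` of nonnegative independent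
terms of mean `μ` and second moment `m`. -/
structure RandomSum {Ω : Type*} [MeasurableSpace Ω] (P : Measure Ω) (N : Ω → ℕ)
    (ξ : ℕ → Ω → ℝ) (μ m : ℝ) : Prop where
  measurable_N : Measurable N
  measurable_term : ∀ j, Measurable (ξ j)
  nonneg : ∀ j ω, 0 ≤ ξ j ω
  memLp : ∀ j, MemLp (ξ j) 2 P
  mean : ∀ j, ∫ ω, ξ j ω ∂P = μ
  secondMoment : ∀ j, ∫ ω, ξ j ω ^ 2 ∂P = m
  iIndepFun_terms : iIndepFun ξ P
  indepFun : IndepFun N (fun ω j => ξ j ω) P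

namespace RandomSum

variable {Ω : Type*} [MeasurableSpace Ω] {P : Measure Ω} {N : Ω → ℕ}
  {ξ : ℕ → Ω → ℝ} {μ m : ℝ}

lemma mean_nonneg (h : RandomSum P N ξ μ m) : 0 ≤ μ := by
  rw [← h.mean 0]; exact integral_nonneg (h.nonneg 0)

lemma secondMoment_nonneg (h : RandomSum P N ξ μ m) : 0 ≤ m := by
  rw [← h.secondMoment 0]; exact integral_nonneg fun ω => sq_nonneg _

lemma measurable_sum (h : RandomSum P N ξ μ m) :
    Measurable fun ω => ∑ j ∈ Finset.range (N ω), ξ j ω :=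
  measurable_sum_range h.measurable_N h.measurable_term

variable [IsProbabilityMeasure P]

lemma integrable (h : RandomSum P N ξ μ m) (j : ℕ) : Integrable (ξ j) P :=
  (h.memLp j).integrable one_le_two

/-- Independence allows the number of terms to be frozen while the terms are integrated. -/
lemma lintegral_eq (h : RandomSum P N ξ μ m) {φ : ℕ → ℝ → ENNReal} (hφ : ∀ n, Measurable (φ n)) :
    ∫⁻ ω, φ (N ω) (∑ j ∈ Finset.range (N ω), ξ j ω) ∂P =
      ∫⁻ ω, ∫⁻ ω', φ (N ω) (∑ j ∈ Finset.range (N ω), ξ j ω') ∂P ∂P := by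
  have hm : Measurable fun q : ℕ × (ℕ → ℝ) => φ q.1 (∑ j ∈ Finset.range q.1, q.2 j) :=
    measurable_from_prod_countable_right fun n => (hφ n).comp
      (Finset.measurable_fun_sum (Finset.range n) fun j _ => measurable_pi_apply j)
  exact lintegral_of_indepFun h.measurable_N (measurable_pi_lambda _ h.measurable_term)
    h.indepFun hm

/-- Wald's identity. The terms are nonnegative, so the extended integral is computed first and
integrability follows from its finiteness. -/
lemma integrable_sum_and_integral (h : RandomSum P N ξ μ m)
    (hN : Integrable (fun ω => (N ω : ℝ)) P) :
    Integrable (fun ω => ∑ j ∈ Finset.range (N ω), ξ j ω) P ∧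
      ∫ ω, ∑ j ∈ Finset.range (N ω), ξ j ω ∂P = μ * ∫ ω, (N ω : ℝ) ∂P := by
  have h0 (n : ℕ) (ω : Ω) : 0 ≤ ∑ j ∈ Finset.range n, ξ j ω :=
    Finset.sum_nonneg fun j _ => h.nonneg j ω
  have e : ∫⁻ ω, ENNReal.ofReal (∑ j ∈ Finset.range (N ω), ξ j ω) ∂P =
      ENNReal.ofReal (μ * ∫ ω, (N ω : ℝ) ∂P) := by
    rw [h.lintegral_eq (φ := fun _ x => ENNReal.ofReal x) fun _ => ENNReal.measurable_ofReal,
      ← integral_const_mul, ofReal_integral_eq_lintegral_ofReal (hN.const_mul μ)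
        (ae_of_all _ fun ω => mul_nonneg h.mean_nonneg (Nat.cast_nonneg _))]
    refine lintegral_congr fun ω => ?_
    rw [← ofReal_integral_eq_lintegral_ofReal
      (integrable_finsetSum _ fun j _ => h.integrable j) (ae_of_all _ (h0 _)),
      integral_finsetSum _ fun j _ => h.integrable j]
    simp [h.mean, mul_comm]
  refine ⟨⟨h.measurable_sum.aestronglyMeasurable, ?_⟩, ?_⟩
  · rw [hasFiniteIntegral_iff_ofReal (ae_of_all _ fun ω => h0 _ ω), e]
    exact ENNReal.ofReal_lt_top
  · rw [integral_eq_lintegral_of_nonneg_ae (ae_of_all _ fun ω => h0 _ ω)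
      h.measurable_sum.aestronglyMeasurable, e, ENNReal.toReal_ofReal]
    exact mul_nonneg h.mean_nonneg (integral_nonneg fun ω => Nat.cast_nonneg _)

/-- Only finiteness matters here, so Cauchy-Schwarz with the crude bound `m E[N²]` suffices. -/
lemma memLp_sum (h : RandomSum P N ξ μ m) (hN : MemLp (fun ω => (N ω : ℝ)) 2 P) :
    MemLp (fun ω => ∑ j ∈ Finset.range (N ω), ξ j ω) 2 P := by
  rw [memLp_two_iff_integrable_sq h.measurable_sum.aestronglyMeasurable]
  refine (integrable_and_integral_le (h.measurable_sum.pow_const 2).aestronglyMeasurable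
    (fun ω => sq_nonneg _) (B := ∫ ω, m * (N ω : ℝ) ^ 2 ∂P) (integral_nonneg fun ω =>
      mul_nonneg h.secondMoment_nonneg (sq_nonneg _)) ?_).1
  rw [h.lintegral_eq (φ := fun _ x => ENNReal.ofReal (x ^ 2))
    fun _ => ENNReal.measurable_ofReal.comp (measurable_id.pow_const 2),
    ofReal_integral_eq_lintegral_ofReal (hN.integrable_sq.const_mul m)
      (ae_of_all _ fun ω => mul_nonneg h.secondMoment_nonneg (sq_nonneg _))]
  refine lintegral_mono fun ω => ?_
  have hi (j : ℕ) : Integrable (fun ω => ξ j ω ^ 2) P := (h.memLp j).integrable_sq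
  have hI : Integrable (fun ω' => (N ω : ℝ) * ∑ j ∈ Finset.range (N ω), ξ j ω' ^ 2) P :=
    (integrable_finsetSum _ fun j _ => hi j).const_mul _
  calc ∫⁻ ω', ENNReal.ofReal ((∑ j ∈ Finset.range (N ω), ξ j ω') ^ 2) ∂P
      ≤ ∫⁻ ω', ENNReal.ofReal ((N ω : ℝ) * ∑ j ∈ Finset.range (N ω), ξ j ω' ^ 2) ∂P :=
        lintegral_mono fun ω' => ENNReal.ofReal_le_ofReal (by
          simpa using sq_sum_le_card_mul_sum_sq (s := Finset.range (N ω)) (f := fun j => ξ j ω'))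
    _ = ENNReal.ofReal (m * (N ω : ℝ) ^ 2) := by
        rw [← ofReal_integral_eq_lintegral_ofReal hI (ae_of_all _ fun ω' =>
          mul_nonneg (Nat.cast_nonneg _) (Finset.sum_nonneg fun j _ => sq_nonneg _)),
          integral_const_mul, integral_finsetSum _ fun j _ => hi j]
        simp only [h.secondMoment, Finset.sum_const, Finset.card_range, nsmul_eq_mul]
        ring_nf

lemma mgf_neg_le (h : RandomSum P N ξ μ m) {s : ℝ} (hs : 0 ≤ s) (j : ℕ) :
    mgf (ξ j) P (-s) ≤ Real.exp (-s * μ + s ^ 2 * m / 2) := by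
  have hi : Integrable (fun ω => 1 - s * ξ j ω + s ^ 2 / 2 * ξ j ω ^ 2) P :=
    ((integrable_const 1).sub ((h.integrable j).const_mul s)).add
      ((h.memLp j).integrable_sq.const_mul _)
  have hpt (ω : Ω) : Real.exp (-s * ξ j ω) ≤ 1 - s * ξ j ω + s ^ 2 / 2 * ξ j ω ^ 2 := by
    have := exp_neg_le_quadratic (mul_nonneg hs (h.nonneg j ω))
    calc _ = Real.exp (-(s * ξ j ω)) := by ring_nf
      _ ≤ _ := this
      _ = _ := by ring
  calc mgf (ξ j) P (-s) ≤ ∫ ω, (1 - s * ξ j ω + s ^ 2 / 2 * ξ j ω ^ 2) ∂P :=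
        integral_mono_of_nonneg (ae_of_all _ fun ω => (Real.exp_pos _).le) hi (ae_of_all _ hpt)
    _ = (-s * μ + s ^ 2 * m / 2) + 1 := by
        rw [integral_add (f := fun ω => 1 - s * ξ j ω)
          ((integrable_const 1).sub ((h.integrable j).const_mul s))
          ((h.memLp j).integrable_sq.const_mul _),
          integral_sub (integrable_const 1) ((h.integrable j).const_mul s), integral_const_mul,
          integral_const_mul, h.mean, h.secondMoment]
        simp
        ring
    _ ≤ _ := Real.add_one_le_exp _

/-- A sub-Gaussian bound, on the lower side only. At `s = n^(-1/2)` it no longer depends on `n`. -/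
lemma integral_exp_neg_le (h : RandomSum P N ξ μ m) {s : ℝ} (hs : 0 ≤ s) (n : ℕ) :
    Integrable (fun ω => Real.exp (-s * (∑ j ∈ Finset.range n, ξ j ω - n * μ))) P ∧
      ∫ ω, Real.exp (-s * (∑ j ∈ Finset.range n, ξ j ω - n * μ)) ∂P ≤
        Real.exp (n * (s ^ 2 * m / 2)) := by
  have h0 (ω : Ω) : 0 ≤ ∑ j ∈ Finset.range n, ξ j ω := Finset.sum_nonneg fun j _ => h.nonneg j ω
  have hm : Measurable fun ω => ∑ j ∈ Finset.range n, ξ j ω :=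
    Finset.measurable_fun_sum _ fun j _ => h.measurable_term j
  constructor
  · refine Integrable.of_bound (((hm.sub_const _).const_mul _).exp.aestronglyMeasurable)
      (Real.exp (s * (n * μ))) (ae_of_all _ fun ω => ?_)
    rw [Real.norm_of_nonneg (Real.exp_pos _).le, Real.exp_le_exp]
    nlinarith [mul_nonneg hs (h0 ω)]
  · have e : ∫ ω, Real.exp (-s * (∑ j ∈ Finset.range n, ξ j ω - n * μ)) ∂P =
        Real.exp (s * (n * μ)) * mgf (∑ j ∈ Finset.range n, ξ j) P (-s) := by
      rw [mgf, ← integral_const_mul]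
      refine integral_congr_ae (ae_of_all _ fun ω => ?_)
      simp only [Finset.sum_apply]
      rw [← Real.exp_add]
      ring_nf
    rw [e, h.iIndepFun_terms.mgf_sum h.measurable_term]
    calc _ ≤ Real.exp (s * (n * μ)) *
          ∏ j ∈ Finset.range n, Real.exp (-s * μ + s ^ 2 * m / 2) := by
          gcongr
          · exact fun j _ => mgf_nonneg
          · exact h.mgf_neg_le hs _
      _ = Real.exp (n * (s ^ 2 * m / 2)) := by
          rw [Finset.prod_const, Finset.card_range, ← Real.exp_nat_mul, ← Real.exp_add]
          ring_nf

/-- Moment bound for the lower deviations of a sum of nonnegative terms. -/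
lemma lintegral_lower_deviation_le (h : RandomSum P N ξ μ m) {q : ℝ} (hq0 : 0 < q) (hq : q ≤ 3)
    (n : ℕ) :
    ∫⁻ ω, ENNReal.ofReal (max 0 (n * μ - ∑ j ∈ Finset.range n, ξ j ω) ^ q) ∂P ≤
      ENNReal.ofReal (7 * (1 + Real.exp (m / 2)) * (n : ℝ) ^ (q / 2)) := by
  rcases Nat.eq_zero_or_pos n with rfl | hn
  · simp [Real.zero_rpow hq0.ne']
  have hn' : (0 : ℝ) < n := by exact_mod_cast hn
  let r := Real.sqrt n
  have hr : 0 < r := Real.sqrt_pos.2 hn'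
  have hr2 : r ^ 2 = n := Real.sq_sqrt hn'.le
  have hrq : (n : ℝ) ^ (q / 2) = r ^ q := by
    rw [← hr2, ← Real.rpow_natCast r 2, ← Real.rpow_mul hr.le]
    congr 1
    push_cast
    ring
  let E (ω : Ω) := Real.exp (-r⁻¹ * (∑ j ∈ Finset.range n, ξ j ω - n * μ))
  obtain ⟨hEi, hE⟩ := h.integral_exp_neg_le (inv_nonneg.2 hr.le) n
  -- After division by `r = √n`, the power is dominated by an exponential, and the exponential of a
  -- positive part by `1 + E`.
  have hpt (ω : Ω) : max 0 (n * μ - ∑ j ∈ Finset.range n, ξ j ω) ^ q ≤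
      7 * (n : ℝ) ^ (q / 2) * (1 + E ω) := by
    set d := n * μ - ∑ j ∈ Finset.range n, ξ j ω
    have hd : max 0 d = r * max 0 (r⁻¹ * d) := by
      rw [mul_max_of_nonneg _ _ hr.le, mul_zero, mul_inv_cancel_left₀ hr.ne']
    rw [hd, Real.mul_rpow hr.le (le_max_left _ _), hrq]
    have h1 := rpow_le_exp (le_max_left 0 (r⁻¹ * d)) hq0.le hq
    have hEd : E ω = Real.exp (r⁻¹ * d) := by simp only [E, d]; ring_nf
    have h2 : Real.exp (max 0 (r⁻¹ * d)) ≤ 1 + E ω := by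
      rw [hEd]
      rcases le_total 0 (r⁻¹ * d) with h | h
      · rw [max_eq_right h]; linarith
      · rw [max_eq_left h, Real.exp_zero]; linarith [Real.exp_pos (r⁻¹ * d)]
    have := Real.rpow_pos_of_pos hr q
    nlinarith
  refine (lintegral_mono fun ω => ENNReal.ofReal_le_ofReal (hpt ω)).trans ?_
  have hint : Integrable (fun ω => 7 * (n : ℝ) ^ (q / 2) * (1 + E ω)) P :=
    ((integrable_const 1).add hEi).const_mul _
  rw [← ofReal_integral_eq_lintegral_ofReal hint (ae_of_all _ fun ω => by
    have := Real.exp_pos (-r⁻¹ * (∑ j ∈ Finset.range n, ξ j ω - n * μ))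
    simp only [E]
    positivity), integral_const_mul, integral_add (integrable_const 1) hEi]
  refine ENNReal.ofReal_le_ofReal ?_
  have hexp : (n : ℝ) * (r⁻¹ ^ 2 * m / 2) = m / 2 := by
    rw [inv_pow, hr2]; field_simp
  rw [hexp] at hE
  have : (∫ ω, E ω ∂P) ≤ Real.exp (m / 2) := hE
  have hnq : 0 ≤ (n : ℝ) ^ (q / 2) := Real.rpow_nonneg hn'.le _
  simp only [integral_const, probReal_univ, smul_eq_mul, mul_one]
  nlinarith

lemma integrable_lower_deviation (h : RandomSum P N ξ μ m) {q : ℝ} (hq0 : 0 < q) (hq : q ≤ 3)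
    (hN : Integrable (fun ω => (N ω : ℝ) ^ (q / 2)) P) :
    Integrable (fun ω => max 0 (N ω * μ - ∑ j ∈ Finset.range (N ω), ξ j ω) ^ q) P ∧
      ∫ ω, max 0 (N ω * μ - ∑ j ∈ Finset.range (N ω), ξ j ω) ^ q ∂P ≤
        7 * (1 + Real.exp (m / 2)) * ∫ ω, (N ω : ℝ) ^ (q / 2) ∂P := by
  have hNr : Measurable fun ω => (N ω : ℝ) := measurable_from_top.comp h.measurable_N
  have h7 : 0 ≤ 7 * (1 + Real.exp (m / 2)) := by positivity
  have hp0 (ω : Ω) : 0 ≤ (N ω : ℝ) ^ (q / 2) := Real.rpow_nonneg (Nat.cast_nonneg _) _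
  refine integrable_and_integral_le ((measurable_const.max ((hNr.mul_const μ).sub
    h.measurable_sum)).pow_const q).aestronglyMeasurable
    (fun ω => Real.rpow_nonneg (le_max_left _ _) _)
    (mul_nonneg h7 (integral_nonneg hp0)) ?_
  change ∫⁻ ω, ENNReal.ofReal (max 0 (N ω * μ - ∑ j ∈ Finset.range (N ω), ξ j ω) ^ q) ∂P ≤ _
  rw [← integral_const_mul, ofReal_integral_eq_lintegral_ofReal (hN.const_mul _)
    (ae_of_all _ fun ω => mul_nonneg h7 (hp0 ω)),
    h.lintegral_eq (φ := fun n x => ENNReal.ofReal (max 0 (n * μ - x) ^ q)) fun n =>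
      ENNReal.measurable_ofReal.comp
        ((measurable_const.max (measurable_const.sub measurable_id)).pow_const q)]
  exact lintegral_mono fun ω => h.lintegral_lower_deviation_le hq0 hq (N ω)

end RandomSum
end Migration

/-! ### Moments of the weight of the next generation. -/

namespace Migration
namespace MBPM

variable {Ω : Type*} [MeasurableSpace Ω] {P : Measure Ω} {p : ℕ} (S : MBPM P p)

/-- The number of individuals of each type who reproduce, when the first generation is `z`. -/
def size (z : Fin p → ℕ) (ω : Ω) (i : Fin p) : ℕ := ((z i : ℤ) + S.M 0 z ω i).toNat

/-- The weight of the offspring of the `j`-th individual of type `i`. -/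
noncomputable def offspringWeight (u : Fin p → ℝ) (i : Fin p) (j : ℕ) (ω : Ω) : ℝ :=
  u ⬝ᵥ toReal (S.X 0 j i ω)

/-- The truncation in `size` never acts: at most `z i` individuals emigrate. -/
lemma cast_size (z : Fin p → ℕ) (ω : Ω) (i : Fin p) :
    (S.size z ω i : ℝ) = (z i : ℝ) + (S.M 0 z ω i : ℝ) := by
  have h : 0 ≤ (z i : ℤ) + S.M 0 z ω i := by
    unfold M
    rcases S.R 0 z ω i with _ | _ | _
    · simp [migrants]
    · simp only [migrants]; positivity
    · simp only [migrants]
      rcases Nat.eq_zero_or_pos (z i) with h | h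
      · rw [S.D_eq_zero 0 z ω i h]; simp
      · have := (S.D_range 0 z ω i h).2
        omega
  have h' : ((S.size z ω i : ℤ) : ℝ) = ((z i : ℤ) + S.M 0 z ω i : ℤ) := by
    rw [size, Int.toNat_of_nonneg h]
  push_cast at h'
  exact h'

lemma measurable_size (z : Fin p → ℕ) (i : Fin p) : Measurable fun ω => S.size z ω i :=
  (Measurable.of_discrete (f := fun m : ℤ => ((z i : ℤ) + m).toNat)).comp
    ((measurable_pi_apply i).comp (S.measurable_M 0 z))

lemma dotProduct_step (u : Fin p → ℝ) (z : Fin p → ℕ) (ω : Ω) :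
    u ⬝ᵥ toReal (S.step 0 z ω) =
      ∑ i, ∑ j ∈ Finset.range (S.size z ω i), S.offspringWeight u i j ω := by
  simp only [dotProduct, toReal, step, offspringWeight, Finset.sum_apply, Nat.cast_sum,
    Finset.mul_sum, size]
  rw [Finset.sum_comm]
  exact Finset.sum_congr rfl fun i _ => Finset.sum_comm

lemma measurable_dotProduct_toReal (u : Fin p → ℝ) :
    Measurable fun y : Fin p → ℕ => u ⬝ᵥ toReal y := Measurable.of_discrete

lemma measurable_dotProduct_step (u : Fin p → ℝ) (z : Fin p → ℕ) :
    Measurable fun ω => u ⬝ᵥ toReal (S.step 0 z ω) :=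
  (measurable_dotProduct_toReal u).comp (S.measurable_step 0 z)

lemma indepFun_size_offspringWeight [IsProbabilityMeasure P] (u : Fin p → ℝ) (z : Fin p → ℕ)
    (i : Fin p) :
    IndepFun (fun ω => S.size z ω i) (fun ω j => S.offspringWeight u i j ω) P := by
  let m (s : Source p) : MeasurableSpace Ω := MeasurableSpace.comap (S.family s) inferInstance
  have hdisj : Disjoint {Source.migration 0 z} (Set.range fun j : ℕ => Source.offspring 0 j i) := by
    rw [Set.disjoint_singleton_left]
    rintro ⟨j, hj⟩
    cases hj
  have h := indep_iSup_of_disjoint (m := m) (fun s => (S.measurable_family s).comap_le)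
    S.iIndepFun_family hdisj
  refine indep_of_indep_of_le_left (indep_of_indep_of_le_right h ?_) ?_
  · have hj (j : ℕ) : Measurable[⨆ s ∈ Set.range fun j : ℕ => Source.offspring 0 j i, m s]
        (S.offspringWeight u i j) := by
      have hc : Measurable fun y : Fin p → ℤ => u ⬝ᵥ fun l => (y l : ℝ) := Measurable.of_discrete
      exact hc.comp (measurable_iff_comap_le.2
        (le_iSup₂_of_le (f := fun s _ => m s) (Source.offspring 0 j i) ⟨j, rfl⟩ le_rfl))
    exact measurable_iff_comap_le.1 (@measurable_pi_lambda _ _ _ (_) _ _ hj)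
  · have hc : Measurable fun y : Fin p → ℤ => ((z i : ℤ) + y i).toNat := Measurable.of_discrete
    have hM : Measurable[⨆ s ∈ {Source.migration 0 z}, m s] (S.family (.migration 0 z)) :=
      measurable_iff_comap_le.2
        (le_iSup₂_of_le (f := fun s _ => m s) (Source.migration 0 z)
          (Set.mem_singleton _) le_rfl)
    exact measurable_iff_comap_le.1 (hc.comp hM)

variable {S} in
-- The mean weight of the children of an individual of type `i` is `u i`: this is the eigenvector
-- equation.
lemma FiniteMoments.randomSum [IsProbabilityMeasure P] (hmom : S.FiniteMoments) {u : Fin p → ℝ}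
    (hu : S.IsLeftPerron u) (z : Fin p → ℕ) (i : Fin p) :
    RandomSum P (fun ω => S.size z ω i) (S.offspringWeight u i) (u i)
      (∫ ω, S.offspringWeight u i 0 ω ^ 2 ∂P) := by
  have hid (j : ℕ) : IdentDistrib (S.offspringWeight u i j) (S.offspringWeight u i 0) P P :=
    (S.identDistrib_X 0 j i).comp (measurable_dotProduct_toReal u)
  have hw (j : ℕ) : S.offspringWeight u i j = fun ω => ∑ l, u l * (S.X 0 j i ω l : ℝ) := rfl
  have hlp : MemLp (S.offspringWeight u i 0) 2 P := by
    rw [hw]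
    exact memLp_finsetSum _ fun l _ => (hmom.offspring i l).const_mul (u l)
  refine ⟨S.measurable_size z i, fun j => (measurable_dotProduct_toReal u).comp
    (S.measurable_X 0 j i), fun j ω => by
      rw [hw]; exact Finset.sum_nonneg fun l _ => mul_nonneg (hu.pos l).le (Nat.cast_nonneg _), fun j => (hid j).memLp_iff.2 hlp, fun j => ?_, fun j => ?_, ?_,
    S.indepFun_size_offspringWeight u z i⟩
  · rw [(hid j).integral_eq]
    have h : ∫ ω, S.offspringWeight u i 0 ω ∂P = ∑ l, ∫ ω, u l * (S.X 0 0 i ω l : ℝ) ∂P := by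
      rw [hw]
      exact integral_finsetSum _ fun l _ => ((hmom.offspring i l).integrable one_le_two).const_mul (u l)
    rw [h]
    simp_rw [integral_const_mul]
    exact congr_fun hu.eigen i
  · exact ((hid j).comp (measurable_id.pow_const 2)).integral_eq
  · have hc : Measurable fun y : Fin p → ℤ => u ⬝ᵥ fun l => (y l : ℝ) := Measurable.of_discrete
    exact (S.iIndepFun_family.precomp (g := fun j : ℕ => Source.offspring 0 j i)
      fun j j' h => by injection h).comp (fun _ => fun y => u ⬝ᵥ fun l => (y l : ℝ)) fun _ => hc

variable {S} in
lemma FiniteMoments.integrable_size (hmom : S.FiniteMoments) [IsProbabilityMeasure P]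
    (z : Fin p → ℕ) (i : Fin p) :
    Integrable (fun ω => (S.size z ω i : ℝ)) P ∧
      ∫ ω, (S.size z ω i : ℝ) ∂P = z i + S.h z i := by
  simp_rw [S.cast_size]
  refine ⟨(integrable_const _).add (hmom.migration z i), ?_⟩
  rw [integral_add (integrable_const _) (hmom.migration z i)]
  simp [h]

variable {S} in
-- By Wald's identity each reproducing individual of type `i` contributes its own weight `u i`, so
-- migration alone creates drift.
lemma FiniteMoments.integral_dotProduct_step [IsProbabilityMeasure P] (hmom : S.FiniteMoments)
    {u : Fin p → ℝ} (hu : S.IsLeftPerron u) (z : Fin p → ℕ) :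
    ∫ ω, u ⬝ᵥ toReal (S.step 0 z ω) ∂P = u ⬝ᵥ toReal z + u ⬝ᵥ S.h z := by
  simp_rw [S.dotProduct_step]
  rw [integral_finsetSum _ fun i _ => ((hmom.randomSum hu z i).integrable_sum_and_integral
    (hmom.integrable_size z i).1).1, ← dotProduct_add]
  refine Finset.sum_congr rfl fun i _ => ?_
  rw [((hmom.randomSum hu z i).integrable_sum_and_integral (hmom.integrable_size z i).1).2,
    (hmom.integrable_size z i).2]
  rfl

variable {S} in
lemma FiniteMoments.memLp_dotProduct_step [IsProbabilityMeasure P] (hmom : S.FiniteMoments)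
    {u : Fin p → ℝ} (hu : S.IsLeftPerron u) {z : Fin p → ℕ} {q : ℝ} (hq : 2 ≤ q)
    (hM : ∀ i, Integrable (fun ω => |(S.M 0 z ω i : ℝ) - S.h z i| ^ q) P) :
    MemLp (fun ω => u ⬝ᵥ toReal (S.step 0 z ω)) 2 P := by
  simp_rw [S.dotProduct_step]
  refine memLp_finsetSum _ fun i _ => (hmom.randomSum hu z i).memLp_sum ?_
  have hMm : Measurable fun ω => (S.M 0 z ω i : ℝ) :=
    measurable_from_top.comp ((measurable_pi_apply i).comp (S.measurable_M 0 z))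
  have h2 : MemLp (fun ω => (S.M 0 z ω i : ℝ) - S.h z i) 2 P := by
    rw [memLp_two_iff_integrable_sq (hMm.sub_const _).aestronglyMeasurable]
    refine ((integrable_const 1).add (hM i)).mono'
      ((hMm.sub_const _).pow_const 2).aestronglyMeasurable (ae_of_all _ fun ω => ?_)
    rw [Real.norm_of_nonneg (sq_nonneg _), ← sq_abs]
    have h0 := abs_nonneg ((S.M 0 z ω i : ℝ) - S.h z i)
    set t := |(S.M 0 z ω i : ℝ) - S.h z i| with ht
    change t ^ 2 ≤ 1 + |(S.M 0 z ω i : ℝ) - S.h z i| ^ q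
    rw [← ht]
    rcases le_total t 1 with h1 | h1
    · have := Real.rpow_nonneg h0 q
      nlinarith
    · have : t ^ (2 : ℝ) ≤ t ^ q := Real.rpow_le_rpow_of_exponent_le h1 hq
      rw [Real.rpow_two] at this
      linarith
  have h3 : (fun ω => (S.size z ω i : ℝ)) =
      fun ω => ((S.M 0 z ω i : ℝ) - S.h z i) + (z i + S.h z i) := by
    funext ω
    rw [S.cast_size]
    ring
  rw [h3]
  exact h2.add (memLp_const _)

variable {S} in
-- The Taylor expansion is centred at the current weight and not at the mean of the next one; the
-- bias adds the square of the drift.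
lemma FiniteMoments.integral_sq_dotProduct_step [IsProbabilityMeasure P] (hmom : S.FiniteMoments)
    {u : Fin p → ℝ} (hu : S.IsLeftPerron u) {z : Fin p → ℕ}
    (hY : MemLp (fun ω => u ⬝ᵥ toReal (S.step 0 z ω)) 2 P) :
    ∫ ω, (u ⬝ᵥ toReal (S.step 0 z ω) - u ⬝ᵥ toReal z) ^ 2 ∂P =
      S.sigmaSq u z + (u ⬝ᵥ S.h z) ^ 2 := by
  have hc : MemLp (fun ω => u ⬝ᵥ toReal (S.step 0 z ω) - u ⬝ᵥ toReal z) 2 P :=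
    hY.sub (memLp_const _)
  have h := variance_eq_sub hc
  rw [variance_sub_const hY.aestronglyMeasurable] at h
  have hmean : ∫ ω, (u ⬝ᵥ toReal (S.step 0 z ω) - u ⬝ᵥ toReal z) ∂P = u ⬝ᵥ S.h z := by
    rw [integral_sub (hY.integrable one_le_two) (integrable_const _),
      hmom.integral_dotProduct_step hu]
    simp
  rw [hmean] at h
  simp only [sigmaSq]
  rw [h]
  simp

variable {S} in
/-- Moment bound for the lower deviations of the weight of the next generation. -/
lemma FiniteMoments.exists_integral_lower_deviation_le [IsProbabilityMeasure P]
    (hmom : S.FiniteMoments) {u : Fin p → ℝ} (hu : S.IsLeftPerron u) {q : ℝ} (hq1 : 1 ≤ q)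
    (hq : q ≤ 3) :
    ∃ C : ℝ, 0 ≤ C ∧ ∀ z : Fin p → ℕ, 0 ≤ u ⬝ᵥ S.h z →
      (∀ i, Integrable (fun ω => |(z i : ℝ) + (S.M 0 z ω i : ℝ)| ^ (q / 2)) P) →
      (∀ i, Integrable (fun ω => |(S.M 0 z ω i : ℝ) - S.h z i| ^ q) P) →
      ∫ ω, max 0 (u ⬝ᵥ toReal z - u ⬝ᵥ toReal (S.step 0 z ω)) ^ q ∂P ≤
        C * ∑ i, (∫ ω, |(z i : ℝ) + (S.M 0 z ω i : ℝ)| ^ (q / 2) ∂P +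
          ∫ ω, |(S.M 0 z ω i : ℝ) - S.h z i| ^ q ∂P) := by
  have hq0 : 0 < q := by linarith
  let D (i : Fin p) : ℝ := 7 * (1 + Real.exp ((∫ ω, S.offspringWeight u i 0 ω ^ 2 ∂P) / 2))
  have hD (i : Fin p) : 0 ≤ D i := by simp only [D]; positivity
  let E : ℝ := 1 + ∑ i, D i
  have hDE (i : Fin p) : D i ≤ E := by
    have := Finset.single_le_sum (fun i _ => hD i) (Finset.mem_univ i)
    simp only [E]; linarith
  have hE1 : 1 ≤ E := by
    have := Finset.sum_nonneg fun i (_ : i ∈ Finset.univ) => hD i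
    simp only [E]; linarith
  let c : ℝ := ((Finset.univ : Finset (Fin p)).card : ℝ) ^ (q - 1) * 2 ^ (q - 1)
  have hc : 0 ≤ c := by positivity
  refine ⟨c * E, mul_nonneg hc (by linarith), fun z hg hN hM => ?_⟩
  let V (i : Fin p) (ω : Ω) : ℝ :=
    max 0 (S.size z ω i * u i - ∑ j ∈ Finset.range (S.size z ω i), S.offspringWeight u i j ω)
  have hsize (i : Fin p) (ω : Ω) : (S.size z ω i : ℝ) ^ (q / 2) =
      |(z i : ℝ) + (S.M 0 z ω i : ℝ)| ^ (q / 2) := by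
    rw [← S.cast_size, abs_of_nonneg (Nat.cast_nonneg _)]
  have hV (i : Fin p) := (hmom.randomSum hu z i).integrable_lower_deviation hq0 hq
    (by simpa only [hsize] using hN i)
  have hu1 (i : Fin p) : u i ≤ 1 := by
    rw [← hu.sum_eq_one]
    exact Finset.single_le_sum (fun i _ => (hu.pos i).le) (Finset.mem_univ i)
  have hV0 (i : Fin p) (ω : Ω) : 0 ≤ V i ω := le_max_left _ _
  have hpt (ω : Ω) : max 0 (u ⬝ᵥ toReal z - u ⬝ᵥ toReal (S.step 0 z ω)) ^ q ≤
      c * ∑ i, (V i ω ^ q + |(S.M 0 z ω i : ℝ) - S.h z i| ^ q) := by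
    -- The decrease of weight splits into the offspring deficits, the terms `-u i * (M i - h i)` and
    -- `-uᵀh`. The last is nonpositive and is dropped; `u i ≤ 1` bounds the second.
    have h1 : max 0 (u ⬝ᵥ toReal z - u ⬝ᵥ toReal (S.step 0 z ω)) ≤
        ∑ i, (V i ω + |(S.M 0 z ω i : ℝ) - S.h z i|) := by
      refine max_le (Finset.sum_nonneg fun i _ => add_nonneg (hV0 i ω) (abs_nonneg _)) ?_
      have hterm (i : Fin p) : u i * z i - u i * S.h z i * (-1) -
          ∑ j ∈ Finset.range (S.size z ω i), S.offspringWeight u i j ω ≤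
          V i ω + |(S.M 0 z ω i : ℝ) - S.h z i| := by
        have a1 : S.size z ω i * u i -
            ∑ j ∈ Finset.range (S.size z ω i), S.offspringWeight u i j ω ≤ V i ω :=
          le_max_right _ _
        rw [S.cast_size] at a1
        have a2 := neg_abs_le ((S.M 0 z ω i : ℝ) - S.h z i)
        have a3 := abs_nonneg ((S.M 0 z ω i : ℝ) - S.h z i)
        have a4 := hu.pos i
        have a5 : -|(S.M 0 z ω i : ℝ) - S.h z i| ≤ u i * ((S.M 0 z ω i : ℝ) - S.h z i) := by
          nlinarith [hu1 i]
        nlinarith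
      have hsum := Finset.sum_le_sum fun i (_ : i ∈ Finset.univ) => hterm i
      rw [Finset.sum_sub_distrib, Finset.sum_sub_distrib, ← S.dotProduct_step,
        ← Finset.sum_mul] at hsum
      change u ⬝ᵥ toReal z - (u ⬝ᵥ S.h z) * (-1) - _ ≤ _ at hsum
      linarith
    calc max 0 (u ⬝ᵥ toReal z - u ⬝ᵥ toReal (S.step 0 z ω)) ^ q
        ≤ (∑ i, (V i ω + |(S.M 0 z ω i : ℝ) - S.h z i|)) ^ q :=
          Real.rpow_le_rpow (le_max_left _ _) h1 hq0.le
      _ ≤ ((Finset.univ : Finset (Fin p)).card : ℝ) ^ (q - 1) *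
          ∑ i, (V i ω + |(S.M 0 z ω i : ℝ) - S.h z i|) ^ q :=
          Real.rpow_sum_le_const_mul_sum_rpow_of_nonneg _ hq1
            fun i _ => add_nonneg (hV0 i ω) (abs_nonneg _)
      _ ≤ ((Finset.univ : Finset (Fin p)).card : ℝ) ^ (q - 1) *
          ∑ i, 2 ^ (q - 1) * (V i ω ^ q + |(S.M 0 z ω i : ℝ) - S.h z i| ^ q) := by
          gcongr with i
          exact_mod_cast NNReal.rpow_add_le_mul_rpow_add_rpow (⟨V i ω, hV0 i ω⟩ : NNReal)
            ⟨|(S.M 0 z ω i : ℝ) - S.h z i|, abs_nonneg _⟩ hq1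
      _ = _ := by rw [← Finset.mul_sum, ← mul_assoc]
  have hVi (i : Fin p) : Integrable (fun ω => V i ω ^ q) P := (hV i).1
  have hint (i : Fin p) :
      Integrable (fun ω => V i ω ^ q + |(S.M 0 z ω i : ℝ) - S.h z i| ^ q) P :=
    (hVi i).add (hM i)
  calc ∫ ω, max 0 (u ⬝ᵥ toReal z - u ⬝ᵥ toReal (S.step 0 z ω)) ^ q ∂P
      ≤ ∫ ω, c * ∑ i, (V i ω ^ q + |(S.M 0 z ω i : ℝ) - S.h z i| ^ q) ∂P :=
        integral_mono_of_nonneg (ae_of_all _ fun ω => Real.rpow_nonneg (le_max_left _ _) _)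
          ((integrable_finsetSum _ fun i _ => hint i).const_mul c) (ae_of_all _ hpt)
    _ = c * ∑ i, (∫ ω, V i ω ^ q ∂P + ∫ ω, |(S.M 0 z ω i : ℝ) - S.h z i| ^ q ∂P) := by
        rw [integral_const_mul, integral_finsetSum _ fun i _ => hint i]
        congr 1
        exact Finset.sum_congr rfl fun i _ => integral_add (hVi i) (hM i)
    _ ≤ c * ∑ i, (E * ∫ ω, |(z i : ℝ) + (S.M 0 z ω i : ℝ)| ^ (q / 2) ∂P +
          E * ∫ ω, |(S.M 0 z ω i : ℝ) - S.h z i| ^ q ∂P) := by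
        gcongr with i
        · refine (hV i).2.trans ?_
          simp_rw [hsize]
          exact mul_le_mul_of_nonneg_right (hDE i)
            (integral_nonneg fun ω => Real.rpow_nonneg (abs_nonneg _) _)
        · exact le_mul_of_one_le_left
            (integral_nonneg fun ω => Real.rpow_nonneg (abs_nonneg _) _) hE1
    _ = _ := by
        simp_rw [← mul_add]
        rw [← Finset.mul_sum, mul_assoc c E]

end MBPM
end Migration

/-! ### The Lyapunov function and its Taylor bound. -/

namespace Migration

/-- The Lyapunov function `(log (e + y))^(-α)`. -/
noncomputable def lyapunov (α y : ℝ) : ℝ := Real.log (Real.exp 1 + y) ^ (-α)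

/-- The opposite of the derivative of the Lyapunov function. -/
noncomputable def lyapunovSlope (α y : ℝ) : ℝ :=
  α * (Real.exp 1 + y)⁻¹ * Real.log (Real.exp 1 + y) ^ (-α - 1)

/-- The second derivative of the Lyapunov function. -/
noncomputable def lyapunovCurvature (α y : ℝ) : ℝ :=
  lyapunovSlope α y * (Real.exp 1 + y)⁻¹ * (1 + (α + 1) * (Real.log (Real.exp 1 + y))⁻¹)

/-- This is the purpose of the shift by `e`: on `[0, ∞)` the Lyapunov function is smooth and at most
`1`. -/
lemma one_le_log_exp_add {y : ℝ} (hy : 0 ≤ y) : 1 ≤ Real.log (Real.exp 1 + y) := by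
  rw [Real.le_log_iff_exp_le (by positivity)]
  linarith

lemma hasDerivAt_lyapunov (α : ℝ) {y : ℝ} (hy : 0 ≤ y) :
    HasDerivAt (lyapunov α) (-lyapunovSlope α y) y := by
  have hL := one_le_log_exp_add hy
  have hX : 0 < Real.exp 1 + y := by positivity
  have h := (((hasDerivAt_id y).const_add (Real.exp 1)).log hX.ne').rpow_const (p := -α)
    (Or.inl (by simp only [id]; linarith))
  refine h.congr_deriv ?_
  simp only [lyapunovSlope, id]
  field_simp

lemma hasDerivAt_lyapunovSlope (α : ℝ) {y : ℝ} (hy : 0 ≤ y) :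
    HasDerivAt (fun y => -lyapunovSlope α y) (lyapunovCurvature α y) y := by
  have hL := one_le_log_exp_add hy
  have hL0 : 0 < Real.log (Real.exp 1 + y) := by linarith
  have hX : 0 < Real.exp 1 + y := by positivity
  have h1 := (((hasDerivAt_id y).const_add (Real.exp 1)).log hX.ne').rpow_const (p := -α - 1)
    (Or.inl (by simp only [id]; linarith))
  have h2 := (((hasDerivAt_id y).const_add (Real.exp 1)).inv hX.ne').const_mul α
  have h := (h2.mul h1).neg
  refine h.congr_deriv ?_
  simp only [lyapunovCurvature, lyapunovSlope, id, Pi.inv_apply]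
  rw [Real.rpow_sub_one hL0.ne' (-α - 1)]
  field_simp
  ring

lemma lyapunov_nonneg (α : ℝ) {y : ℝ} (hy : 0 ≤ y) : 0 ≤ lyapunov α y :=
  Real.rpow_nonneg (by linarith [one_le_log_exp_add hy]) _

lemma lyapunov_le_one {α y : ℝ} (hα : 0 < α) (hy : 0 ≤ y) : lyapunov α y ≤ 1 :=
  Real.rpow_le_one_of_one_le_of_nonpos (one_le_log_exp_add hy) (by linarith)

lemma lyapunov_strictAntiOn {α : ℝ} (hα : 0 < α) : StrictAntiOn (lyapunov α) (Set.Ici 0) := by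
  intro x hx y hy hxy
  have hx' : 0 ≤ x := hx
  have hL := one_le_log_exp_add hx'
  refine Real.rpow_lt_rpow_of_neg (by linarith) ?_ (by linarith)
  exact Real.log_lt_log (by positivity) (by linarith)

lemma tendsto_log_exp_add : Tendsto (fun y : ℝ => Real.log (Real.exp 1 + y)) atTop atTop :=
  Real.tendsto_log_atTop.comp (tendsto_atTop_add_const_left _ _ tendsto_id)

lemma tendsto_lyapunov {α : ℝ} (hα : 0 < α) : Tendsto (lyapunov α) atTop (nhds 0) :=
  (tendsto_rpow_neg_atTop hα).comp tendsto_log_exp_add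

lemma lyapunovSlope_pos {α y : ℝ} (hα : 0 < α) (hy : 0 ≤ y) : 0 < lyapunovSlope α y := by
  have h := Real.rpow_pos_of_pos (zero_lt_one.trans_le (one_le_log_exp_add hy)) (-α - 1)
  unfold lyapunovSlope
  positivity

lemma lyapunovSlope_antitoneOn {α : ℝ} (hα : 0 < α) :
    AntitoneOn (lyapunovSlope α) (Set.Ici 0) := by
  intro x hx y hy hxy
  have hx' : 0 ≤ x := hx
  have hL := one_le_log_exp_add hx'
  have h := Real.rpow_le_rpow_of_nonpos (zero_lt_one.trans_le hL)
    (Real.log_le_log (x := Real.exp 1 + x) (y := Real.exp 1 + y) (by positivity) (by linarith))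
    (show -α - 1 ≤ 0 by linarith)
  have hpos := Real.rpow_nonneg (zero_le_one.trans (one_le_log_exp_add (hx'.trans hxy))) (-α - 1)
  unfold lyapunovSlope
  gcongr

/-- Thus the value at `s * x` bounds the second derivative at all points above it, however far. -/
lemma lyapunovCurvature_antitoneOn {α : ℝ} (hα : 0 < α) :
    AntitoneOn (lyapunovCurvature α) (Set.Ici 0) := by
  intro x hx y hy hxy
  have hx' : 0 ≤ x := hx
  have hy' : 0 ≤ y := hy
  have hL := one_le_log_exp_add hx'
  have hLy := one_le_log_exp_add hy'
  have h1 := lyapunovSlope_antitoneOn hα hx hy hxy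
  have h2 := (lyapunovSlope_pos hα hx').le
  have h3 := (lyapunovSlope_pos hα hy').le
  unfold lyapunovCurvature
  gcongr

/-- A second order Taylor bound under an upper bound for the second derivative. -/
lemma le_quadratic_of_hasDerivAt {f f' f'' : ℝ → ℝ} {a x B : ℝ} (hax : a < x)
    (hf : ∀ y ≥ a, HasDerivAt f (f' y) y) (hf' : ∀ y ≥ a, HasDerivAt f' (f'' y) y)
    (hB : ∀ y ≥ a, f'' y ≤ B) {y : ℝ} (hy : a ≤ y) :
    f y ≤ f x + f' x * (y - x) + B / 2 * (y - x) ^ 2 := by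
  let ψ (y : ℝ) : ℝ := f x + f' x * (y - x) + B / 2 * (y - x) ^ 2 - f y
  let ψ' (y : ℝ) : ℝ := f' x + B * (y - x) - f' y
  have hψ (y : ℝ) (hy : a ≤ y) : HasDerivAt ψ (ψ' y) y := by
    have hs := (hasDerivAt_id y).sub_const x
    have h := (((hs.const_mul (f' x)).const_add (f x)).add ((hs.pow 2).const_mul (B / 2))).sub
      (hf y hy)
    refine h.congr_deriv ?_
    simp only [ψ', id]
    ring
  have hψ' (y : ℝ) (hy : a ≤ y) : HasDerivAt ψ' (B - f'' y) y := by
    have hs := (hasDerivAt_id y).sub_const x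
    have h := ((hs.const_mul B).const_add (f' x)).sub (hf' y hy)
    refine h.congr_deriv ?_
    ring
  -- The quadratic minus `f` is convex with zero derivative at the interior point `x`, where it
  -- vanishes; this is its minimum.
  have hconv : ConvexOn ℝ (Set.Ici a) ψ := by
    refine convexOn_of_hasDerivWithinAt2_nonneg (convex_Ici a) (f' := ψ')
      (f'' := fun y => B - f'' y)
      (fun y hy => (hψ y hy).continuousAt.continuousWithinAt) ?_ ?_ ?_ <;>
      rw [interior_Ici] <;> intro y hy
    · exact (hψ y (le_of_lt hy)).hasDerivWithinAt
    · exact (hψ' y (le_of_lt hy)).hasDerivWithinAt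
    · exact sub_nonneg.2 (hB y (le_of_lt hy))
  have hx0 : derivWithin ψ (Set.Ioi x) x = 0 := by
    rw [(hψ x hax.le).hasDerivWithinAt.derivWithin (uniqueDiffWithinAt_Ioi x)]
    simp [ψ']
  have hmin := hconv.isMinOn_of_rightDeriv_eq_zero (by rw [interior_Ici]; exact hax) hx0
  have h := isMinOn_iff.1 hmin y hy
  simp only [ψ, sub_self] at h
  norm_num at h
  linarith

/-- The logarithm varies slowly, so replacing `s * x` by `x` costs asymptotically only the factor
`s⁻²`. This is taken equal to `1 + κ/2`, and the other `κ/2` absorbs the logarithmic corrections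
collected in `r`. -/
lemma eventually_lyapunovCurvature_le {α κ : ℝ} (hα : 0 < α) (hκ : 0 < κ) :
    ∃ s : ℝ, 0 < s ∧ s < 1 ∧ ∀ᶠ x in atTop,
      lyapunovCurvature α (s * x) ≤ (1 + κ) * (lyapunovSlope α x * (Real.exp 1 + x)⁻¹) := by
  let s : ℝ := Real.sqrt (1 + κ / 2)⁻¹
  have hs2 : s ^ 2 = (1 + κ / 2)⁻¹ := Real.sq_sqrt (by positivity)
  have hs0 : 0 < s := Real.sqrt_pos.2 (by positivity)
  have hs1 : s < 1 := by
    have : s ^ 2 < 1 := by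
      rw [hs2]
      exact inv_lt_one_of_one_lt₀ (by linarith)
    nlinarith
  refine ⟨s, hs0, hs1, ?_⟩
  let c : ℝ := -Real.log s
  have hc : 0 < c := neg_pos.2 (Real.log_neg hs0 hs1)
  let r (t : ℝ) : ℝ := (1 + κ / 2) * (1 + c * t⁻¹) ^ (α + 1) * (1 + (α + 1) * t⁻¹)
  have hr : Tendsto r atTop (nhds (1 + κ / 2)) := by
    have hi : Tendsto (fun t : ℝ => t⁻¹) atTop (nhds 0) := tendsto_inv_atTop_zero
    have h1 : Tendsto (fun t : ℝ => (1 + c * t⁻¹) ^ (α + 1)) atTop (nhds ((1 + c * 0) ^ (α + 1))) :=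
      ((hi.const_mul c).const_add 1).rpow_const (Or.inl (by norm_num))
    have h2 := (h1.const_mul (1 + κ / 2)).mul ((hi.const_mul (α + 1)).const_add 1)
    simpa [r] using h2
  have hlog : Tendsto (fun x : ℝ => Real.log (Real.exp 1 + s * x)) atTop atTop :=
    tendsto_log_exp_add.comp (tendsto_id.const_mul_atTop hs0)
  filter_upwards [(hr.comp hlog).eventually_le_const (show 1 + κ / 2 < 1 + κ by linarith),
    eventually_ge_atTop 0] with x hx hx0
  have hsx : 0 ≤ s * x := by positivity
  have hL1 := one_le_log_exp_add hsx
  have hL := one_le_log_exp_add hx0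
  simp only [Function.comp, r] at hx
  set L1 := Real.log (Real.exp 1 + s * x)
  set L := Real.log (Real.exp 1 + x) with hLdef
  have hX : 0 < Real.exp 1 + x := by positivity
  have hX1 : 0 < Real.exp 1 + s * x := by positivity
  have hXX : s * (Real.exp 1 + x) ≤ Real.exp 1 + s * x := by
    nlinarith [Real.exp_pos 1]
  have hinv : (Real.exp 1 + s * x)⁻¹ ≤ s⁻¹ * (Real.exp 1 + x)⁻¹ := by
    rw [← mul_inv]
    exact inv_anti₀ (by positivity) hXX
  have hLL : L ≤ L1 * (1 + c * L1⁻¹) := by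
    have h1 : Real.log (s * (Real.exp 1 + x)) ≤ L1 := Real.log_le_log (by positivity) hXX
    rw [Real.log_mul hs0.ne' hX.ne'] at h1
    have h2 : L1 * (1 + c * L1⁻¹) = L1 + c := by field_simp
    rw [h2]
    simp only [c]
    linarith
  have hpow : L1 ^ (-α - 1) ≤ (1 + c * L1⁻¹) ^ (α + 1) * L ^ (-α - 1) := by
    have h1 : L ^ (α + 1) ≤ L1 ^ (α + 1) * (1 + c * L1⁻¹) ^ (α + 1) := by
      rw [← Real.mul_rpow (by positivity) (by positivity)]
      exact Real.rpow_le_rpow (by linarith) hLL (by linarith)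
    have e : -α - 1 = -(α + 1) := by ring
    rw [e, Real.rpow_neg (by linarith), Real.rpow_neg (by linarith), ← div_eq_mul_inv,
      le_div_iff₀ (by positivity), inv_mul_le_iff₀ (by positivity)]
    exact h1
  have hs2' : s⁻¹ * s⁻¹ = 1 + κ / 2 := by
    rw [← mul_inv, ← sq, hs2, inv_inv]
  have hLp : 0 < L ^ (-α - 1) := Real.rpow_pos_of_pos (by linarith) _
  have hL1p : 0 < L1 ^ (-α - 1) := Real.rpow_pos_of_pos (by linarith) _
  calc lyapunovCurvature α (s * x)
      = α * (Real.exp 1 + s * x)⁻¹ * L1 ^ (-α - 1) * (Real.exp 1 + s * x)⁻¹ *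
          (1 + (α + 1) * L1⁻¹) := rfl
    _ ≤ α * (s⁻¹ * (Real.exp 1 + x)⁻¹) * ((1 + c * L1⁻¹) ^ (α + 1) * L ^ (-α - 1)) *
          (s⁻¹ * (Real.exp 1 + x)⁻¹) * (1 + (α + 1) * L1⁻¹) := by gcongr
    _ = ((1 + κ / 2) * (1 + c * L1⁻¹) ^ (α + 1) * (1 + (α + 1) * L1⁻¹)) *
          (α * (Real.exp 1 + x)⁻¹ * L ^ (-α - 1) * (Real.exp 1 + x)⁻¹) := by
        rw [← hs2']; ring
    _ ≤ (1 + κ) * (α * (Real.exp 1 + x)⁻¹ * L ^ (-α - 1) * (Real.exp 1 + x)⁻¹) := by gcongr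
    _ = (1 + κ) * (lyapunovSlope α x * (Real.exp 1 + x)⁻¹) := rfl

/-- A Taylor bound for the Lyapunov function, uniform in the second point. -/
lemma exists_lyapunov_le {α κ q : ℝ} (hα : 0 < α) (hκ : 0 < κ) (hq : 0 < q) :
    ∃ C : ℝ, 0 ≤ C ∧ ∀ᶠ x in atTop, ∀ y ≥ 0, lyapunov α y ≤ lyapunov α x
      - lyapunovSlope α x * (y - x)
      + (1 + κ) / 2 * (lyapunovSlope α x * (Real.exp 1 + x)⁻¹) * (y - x) ^ 2
      + C * (max 0 (x - y) ^ q * (x ^ q)⁻¹) := by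
  obtain ⟨s, hs0, hs1, hs⟩ := eventually_lyapunovCurvature_le hα hκ
  have h1s : 0 < 1 - s := by linarith
  refine ⟨((1 - s) ^ q)⁻¹, by positivity, ?_⟩
  filter_upwards [hs, eventually_gt_atTop 0] with x hx hx0 y hy
  have hslope := lyapunovSlope_pos hα hx0.le
  have hX : 0 < Real.exp 1 + x := by positivity
  have hmax : 0 ≤ max 0 (x - y) ^ q := Real.rpow_nonneg (le_max_left _ _) _
  -- Above `s * x` the Taylor bound applies. Below, the decrease is at least `(1 - s) * x`, so the
  -- last term is at least `1 ≥ lyapunov α y`, and the other terms together are nonnegative.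
  rcases le_or_gt (s * x) y with h | h
  · have hT := le_quadratic_of_hasDerivAt (f := lyapunov α) (a := s * x) (x := x)
      (B := (1 + κ) * (lyapunovSlope α x * (Real.exp 1 + x)⁻¹)) (by nlinarith)
      (fun y hy => hasDerivAt_lyapunov α (by nlinarith [mul_pos hs0 hx0]))
      (fun y hy => hasDerivAt_lyapunovSlope α (by nlinarith [mul_pos hs0 hx0]))
      (fun y hy => (lyapunovCurvature_antitoneOn hα (mul_pos hs0 hx0).le
        ((mul_pos hs0 hx0).le.trans hy) hy).trans hx) h
    have h0 : 0 ≤ ((1 - s) ^ q)⁻¹ * (max 0 (x - y) ^ q * (x ^ q)⁻¹) := by positivity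
    linarith
  · have hxy : (1 - s) * x ≤ x - y := by linarith
    have h1 : 1 ≤ ((1 - s) ^ q)⁻¹ * (max 0 (x - y) ^ q * (x ^ q)⁻¹) := by
      have h2 : (1 - s) ^ q * x ^ q ≤ max 0 (x - y) ^ q := by
        rw [← Real.mul_rpow h1s.le hx0.le]
        exact Real.rpow_le_rpow (by positivity) (hxy.trans (le_max_right _ _)) hq.le
      rw [inv_mul_eq_div, ← div_eq_mul_inv, div_div, one_le_div (by positivity), mul_comm]
      exact h2
    have h2 := lyapunov_le_one hα hy
    have h3 := lyapunov_nonneg α hx0.le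
    have h4 : 0 ≤ -(lyapunovSlope α x * (y - x)) := by
      nlinarith [mul_pos h1s hx0, mul_nonneg hslope.le ((mul_pos h1s hx0).le.trans hxy)]
    have h5 : 0 ≤ (1 + κ) / 2 * (lyapunovSlope α x * (Real.exp 1 + x)⁻¹) * (y - x) ^ 2 := by
      positivity
    linarith

/-! ### Supermartingale inequality under a dominating drift. -/

/-- The Lyapunov function decreases in mean, far away, under a positive drift which dominates
the variance. -/
lemma exists_integral_lyapunov_le {α δ c : ℝ} (hα : 0 < α) (hδ : 0 < δ) (hc : 1 < c) :
    ∃ κ > 0, ∃ ε > 0, ∀ᶠ x in atTop, ∀ {Ω : Type*} [MeasurableSpace Ω] (P : Measure Ω)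
      [IsProbabilityMeasure P] (Y : Ω → ℝ) (g v : ℝ), Measurable Y → (∀ ω, 0 ≤ Y ω) →
      MemLp Y 2 P → ∫ ω, Y ω ∂P = x + g → ∫ ω, (Y ω - x) ^ 2 ∂P = v + g ^ 2 → 0 ≤ g →
      c * v ≤ 2 * x * g → g ≤ κ * x →
      ∫ ω, max 0 (x - Y ω) ^ (2 + δ) ∂P ≤ ε * (x ^ (1 + δ) * g / Real.log x ^ (1 + α)) →
      ∫ ω, lyapunov α (Y ω) ∂P ≤ lyapunov α x := by
  -- In units of `D * g`, the variance uses about `a < 1` of the gain. The margin `1 - a = 4κ` pays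
  -- for the errors in `κ` and for the remainder, which is allowed `τ = 2κ`.
  let a := c⁻¹
  have ha0 : 0 < a := by positivity
  have ha1 : a < 1 := inv_lt_one_of_one_lt₀ hc
  let κ := (1 - a) / 4
  have hκ : 0 < κ := by simp only [κ]; linarith
  have hκ1 : κ ≤ 1 := by simp only [κ]; linarith
  obtain ⟨C, hC, hev⟩ := exists_lyapunov_le hα hκ (show 0 < 2 + δ by linarith)
  let τ := (1 - a) / 2
  have hτ : 0 < τ := by simp only [τ]; linarith
  have h2p : (0 : ℝ) < 2 ^ (α + 1) := by positivity
  -- The factor `2 * 2 ^ (α + 1)` comes from `e + x ≤ 2x` and `log (e + x) ≤ 2 log x`, valid for `x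
  -- ≥ e`; `C + 1` avoids division by zero.
  let ε := τ * α / ((C + 1) * (2 * 2 ^ (α + 1)))
  have hε : 0 < ε := by positivity
  refine ⟨κ, hκ, ε, hε, ?_⟩
  filter_upwards [hev, eventually_ge_atTop (Real.exp 1)] with x hx hxe
  intro Ω _ P _ Y g v hYm hY0 hY hmean hsq hg hv hgx hdev
  have hx0 : 0 < x := (Real.exp_pos 1).trans_le hxe
  have hx2 : 2 ≤ x := by
    have := Real.add_one_le_exp (1 : ℝ)
    linarith
  have hX : 0 < Real.exp 1 + x := by positivity
  have hXx : x ≤ Real.exp 1 + x := by linarith [Real.exp_pos 1]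
  set D := lyapunovSlope α x with hD
  have hDpos : 0 < D := lyapunovSlope_pos hα hx0.le
  have hlog1 : 1 ≤ Real.log x := by rwa [Real.le_log_iff_exp_le hx0]
  -- the slope is comparable to `x⁻¹ (log x)^(-1-α)`
  have hDlow : α * (x * Real.log x ^ (1 + α))⁻¹ ≤ 2 * 2 ^ (α + 1) * D := by
    have hL : Real.log (Real.exp 1 + x) ≤ 2 * Real.log x := by
      have h1 : Real.log (Real.exp 1 + x) ≤ Real.log (x * x) :=
        Real.log_le_log hX (by nlinarith)
      rw [Real.log_mul hx0.ne' hx0.ne'] at h1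
      linarith
    have hL0 := one_le_log_exp_add hx0.le
    have hLpow : Real.log (Real.exp 1 + x) ^ (α + 1) ≤ 2 ^ (α + 1) * Real.log x ^ (1 + α) := by
      rw [add_comm 1 α, ← Real.mul_rpow (by norm_num) (by linarith)]
      exact Real.rpow_le_rpow (by linarith) hL (by linarith)
    have hLp : 0 < Real.log (Real.exp 1 + x) ^ (α + 1) := Real.rpow_pos_of_pos (by linarith) _
    have hlp : 0 < Real.log x ^ (1 + α) := Real.rpow_pos_of_pos (by linarith) _
    have hDe : D = α * ((Real.exp 1 + x) * Real.log (Real.exp 1 + x) ^ (α + 1))⁻¹ := by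
      rw [hD, lyapunovSlope, show -α - 1 = -(α + 1) by ring, Real.rpow_neg (by linarith), mul_inv]
      ring
    have hprod : (Real.exp 1 + x) * Real.log (Real.exp 1 + x) ^ (α + 1) ≤
        (2 * 2 ^ (α + 1)) * (x * Real.log x ^ (1 + α)) := by
      calc _ ≤ (2 * x) * (2 ^ (α + 1) * Real.log x ^ (1 + α)) := by
            gcongr
            linarith
        _ = _ := by ring
    have hinv := inv_anti₀ (by positivity) hprod
    rw [mul_inv] at hinv
    rw [hDe]
    calc α * (x * Real.log x ^ (1 + α))⁻¹ = (2 * 2 ^ (α + 1)) * (α * ((2 * 2 ^ (α + 1))⁻¹ *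
          (x * Real.log x ^ (1 + α))⁻¹)) := by field_simp
      _ ≤ _ := by gcongr
  let E (ω : Ω) : ℝ := lyapunov α x - D * (Y ω - x) +
    (1 + κ) / 2 * (D * (Real.exp 1 + x)⁻¹) * (Y ω - x) ^ 2
  have hYi := hY.integrable one_le_two
  have hi1 : Integrable (fun ω => Y ω - x) P := hYi.sub (integrable_const _)
  have hi2 : Integrable (fun ω => (Y ω - x) ^ 2) P := (hY.sub (memLp_const x)).integrable_sq
  have hi3 : Integrable (fun ω => max 0 (x - Y ω) ^ (2 + δ)) P := by
    refine Integrable.of_bound ((measurable_const.max (measurable_const.sub hYm)).pow_const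
      _).aestronglyMeasurable (x ^ (2 + δ)) (ae_of_all _ fun ω => ?_)
    rw [Real.norm_of_nonneg (Real.rpow_nonneg (le_max_left _ _) _)]
    exact Real.rpow_le_rpow (le_max_left _ _) (max_le hx0.le (by linarith [hY0 ω])) (by linarith)
  have hi4 : Integrable (fun ω => lyapunov α x - D * (Y ω - x)) P :=
    (integrable_const _).sub (hi1.const_mul D)
  have hi5 : Integrable E P := hi4.add (hi2.const_mul _)
  have hbound : ∫ ω, lyapunov α (Y ω) ∂P ≤ lyapunov α x - D * g +
      (1 + κ) / 2 * (D * (Real.exp 1 + x)⁻¹) * (v + g ^ 2) +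
      C * ((∫ ω, max 0 (x - Y ω) ^ (2 + δ) ∂P) * (x ^ (2 + δ))⁻¹) := by
    calc ∫ ω, lyapunov α (Y ω) ∂P
        ≤ ∫ ω, (E ω + C * (max 0 (x - Y ω) ^ (2 + δ) * (x ^ (2 + δ))⁻¹)) ∂P :=
          integral_mono_of_nonneg (ae_of_all _ fun ω => lyapunov_nonneg α (hY0 ω))
            (hi5.add ((hi3.mul_const _).const_mul C)) (ae_of_all _ fun ω => hx (Y ω) (hY0 ω))
      _ = _ := by
          have e1 : ∫ ω, (Y ω - x) ∂P = g := by
            rw [integral_sub hYi (integrable_const _), hmean]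
            simp
          rw [integral_add hi5 ((hi3.mul_const _).const_mul C), integral_const_mul,
            integral_mul_const, integral_add hi4 (hi2.const_mul _),
            integral_sub (integrable_const _) (hi1.const_mul D), integral_const_mul,
            integral_const_mul, hsq, e1]
          simp
  refine hbound.trans ?_
  have hDX : D * (Real.exp 1 + x)⁻¹ ≤ D * x⁻¹ := by gcongr
  have hDX0 : 0 ≤ D * (Real.exp 1 + x)⁻¹ := by positivity
  have hv' : v ≤ 2 * a * (x * g) := by
    have : c⁻¹ * (c * v) ≤ c⁻¹ * (2 * x * g) := by gcongr
    rw [inv_mul_cancel_left₀ (by linarith)] at this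
    calc v ≤ _ := this
      _ = _ := by simp only [a]; ring
  have hg2 : g ^ 2 ≤ κ * (x * g) := by nlinarith
  have hquad : (1 + κ) / 2 * (D * (Real.exp 1 + x)⁻¹) * (v + g ^ 2) ≤
      (1 + κ) / 2 * (2 * a + κ) * (D * g) := by
    calc (1 + κ) / 2 * (D * (Real.exp 1 + x)⁻¹) * (v + g ^ 2)
        ≤ (1 + κ) / 2 * (D * (Real.exp 1 + x)⁻¹) * ((2 * a + κ) * (x * g)) := by
          gcongr; linarith
      _ ≤ (1 + κ) / 2 * (D * x⁻¹) * ((2 * a + κ) * (x * g)) := by gcongr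
      _ = _ := by field_simp
  have hrem : C * ((∫ ω, max 0 (x - Y ω) ^ (2 + δ) ∂P) * (x ^ (2 + δ))⁻¹) ≤ τ * (D * g) := by
    calc C * ((∫ ω, max 0 (x - Y ω) ^ (2 + δ) ∂P) * (x ^ (2 + δ))⁻¹)
        ≤ (C + 1) * ((ε * (x ^ (1 + δ) * g / Real.log x ^ (1 + α))) * (x ^ (2 + δ))⁻¹) := by
          have h0 : 0 ≤ ∫ ω, max 0 (x - Y ω) ^ (2 + δ) ∂P :=
            integral_nonneg fun ω => Real.rpow_nonneg (le_max_left _ _) _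
          gcongr
          linarith
      _ = (C + 1) * ε * g * (x * Real.log x ^ (1 + α))⁻¹ := by
          have hxp : x ^ (2 + δ) = x ^ (1 + δ) * x := by
            rw [← Real.rpow_add_one hx0.ne']; ring_nf
          have hxd : 0 < x ^ (1 + δ) := Real.rpow_pos_of_pos hx0 _
          have hlp : 0 < Real.log x ^ (1 + α) := Real.rpow_pos_of_pos (by linarith) _
          rw [hxp]
          field_simp
      _ = τ * g * (2 * 2 ^ (α + 1))⁻¹ * (α * (x * Real.log x ^ (1 + α))⁻¹) := by
          have : C + 1 ≠ 0 := by positivity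
          simp only [ε]
          field_simp
      _ ≤ τ * g * (2 * 2 ^ (α + 1))⁻¹ * (2 * 2 ^ (α + 1) * D) := by gcongr
      _ = τ * (D * g) := by field_simp
  have hcoef : (1 + κ) / 2 * (2 * a + κ) + τ ≤ 1 := by
    have h1 : κ * (a + κ) ≤ κ * 2 := by gcongr; linarith
    have h2 : a = 1 - 4 * κ := by simp only [κ]; ring
    have h3 : τ = 2 * κ := by simp only [τ, κ]; ring
    rw [h3]
    nlinarith
  have := mul_le_mul_of_nonneg_right hcoef (mul_nonneg hDpos.le hg)
  linarith

end Migration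

/-! ### Drift of the branching process at large weights. -/

namespace Migration

lemma lyapunov_pos (α : ℝ) {y : ℝ} (hy : 0 ≤ y) : 0 < lyapunov α y :=
  Real.rpow_pos_of_pos (by linarith [one_le_log_exp_add hy]) _

/-- The liminf condition is used in this form, which needs no division and includes zero variance.
The positivity of `a` gives that of the drift. -/
lemma pos_and_mul_le_of_lt_extQuotient {a b c : ℝ} (hb : 0 ≤ b) (hc : 0 < c)
    (h : (c : EReal) < extQuotient a b) : 0 < a ∧ c * b ≤ a := by
  unfold extQuotient at h
  split_ifs at h with h1 h2
  · exact ⟨h2, by rw [h1, mul_zero]; exact h2.le⟩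
  · exact absurd h not_lt_bot
  · have hb' : 0 < b := lt_of_le_of_ne hb (Ne.symm h1)
    have h3 : c < a / b := EReal.coe_lt_coe_iff.1 h
    rw [lt_div_iff₀ hb'] at h3
    exact ⟨(mul_pos hc hb').trans h3, h3.le⟩

namespace MBPM

variable {Ω : Type*} [MeasurableSpace Ω] {P : Measure Ω} {p : ℕ} {S : MBPM P p} {u : Fin p → ℝ}

lemma IsLeftPerron.dotProduct_le_norm (hu : S.IsLeftPerron u) (z : Fin p → ℕ) :
    u ⬝ᵥ toReal z ≤ ‖toReal z‖ := by
  calc u ⬝ᵥ toReal z ≤ ∑ i, u i * ‖toReal z‖ := Finset.sum_le_sum fun i _ =>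
        mul_le_mul_of_nonneg_left ((le_abs_self _).trans (norm_le_pi_norm (toReal z) i))
          (hu.pos i).le
    _ = ‖toReal z‖ := by rw [← Finset.sum_mul, hu.sum_eq_one, one_mul]

lemma IsLeftPerron.dotProduct_nonneg (hu : S.IsLeftPerron u) (z : Fin p → ℕ) :
    0 ≤ u ⬝ᵥ toReal z :=
  Finset.sum_nonneg fun i _ => mul_nonneg (hu.pos i).le (Nat.cast_nonneg _)

lemma IsLeftPerron.coord_le (hu : S.IsLeftPerron u) (z : Fin p → ℕ) (i : Fin p) :
    (z i : ℝ) ≤ (u i)⁻¹ * (u ⬝ᵥ toReal z) := by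
  rw [le_inv_mul_iff₀ (hu.pos i)]
  exact Finset.single_le_sum (f := fun i => u i * toReal z i)
    (fun i _ => mul_nonneg (hu.pos i).le (Nat.cast_nonneg _)) (Finset.mem_univ i)

lemma IsLeftPerron.sum_le (hu : S.IsLeftPerron u) (z : Fin p → ℕ) :
    ((∑ i, z i : ℕ) : ℝ) ≤ (∑ i, (u i)⁻¹) * (u ⬝ᵥ toReal z) := by
  rw [Finset.sum_mul, Nat.cast_sum]
  exact Finset.sum_le_sum fun i _ => hu.coord_le z i

lemma IsLeftPerron.norm_le (hu : S.IsLeftPerron u) (z : Fin p → ℕ) :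
    ‖toReal z‖ ≤ (∑ i, (u i)⁻¹) * (u ⬝ᵥ toReal z) := by
  refine (pi_norm_le_iff_of_nonneg (mul_nonneg (Finset.sum_nonneg fun i _ =>
    (inv_pos.2 (hu.pos i)).le) (hu.dotProduct_nonneg z))).2 fun i => ?_
  rw [toReal, Real.norm_of_nonneg (Nat.cast_nonneg _)]
  refine (hu.coord_le z i).trans (mul_le_mul_of_nonneg_right ?_ (hu.dotProduct_nonneg z))
  exact Finset.single_le_sum (f := fun i => (u i)⁻¹) (fun i _ => (inv_pos.2 (hu.pos i)).le)
    (Finset.mem_univ i)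

/-- Carries the asymptotic hypotheses over to large weights, where they yield a threshold on `uᵀz`
alone. -/
lemma IsLeftPerron.comap_dotProduct_le (hu : S.IsLeftPerron u) :
    comap (fun z => u ⬝ᵥ toReal z) atTop ≤ normAtTop p :=
  tendsto_iff_comap.1 (tendsto_atTop_mono hu.dotProduct_le_norm tendsto_comap)

/-- Far away, the Lyapunov function of the weight decreases in mean at each transition. -/
lemma exists_integral_lyapunov_step_le [IsProbabilityMeasure P] (hmom : S.FiniteMoments)
    (hB : S.SmallMigration) (hu : S.IsLeftPerron u)
    (hliminf : 1 < liminf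
      (fun z => extQuotient (2 * (u ⬝ᵥ toReal z) * (u ⬝ᵥ S.h z)) (S.sigmaSq u z)) (normAtTop p))
    {δ α : ℝ} (hδ0 : 0 < δ) (hδ1 : δ ≤ 1) (hα : 0 < α)
    (hcond3_int : ∀ i, ∀ᶠ z in normAtTop p,
      Integrable (fun ω => |(z i : ℝ) + (S.M 0 z ω i : ℝ)| ^ (1 + δ / 2)) P)
    (hcond3 : ∀ i, (fun z => ∫ ω, |(z i : ℝ) + (S.M 0 z ω i : ℝ)| ^ (1 + δ / 2) ∂P)
      =o[normAtTop p] S.momentScale u δ α)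
    (hcond4_int : ∀ i, ∀ᶠ z in normAtTop p,
      Integrable (fun ω => |(S.M 0 z ω i : ℝ) - S.h z i| ^ (2 + δ)) P)
    (hcond4 : ∀ i, (fun z => ∫ ω, |(S.M 0 z ω i : ℝ) - S.h z i| ^ (2 + δ) ∂P)
      =o[normAtTop p] S.momentScale u δ α) :
    ∃ x₀ : ℝ, 0 ≤ x₀ ∧ ∀ z : Fin p → ℕ, x₀ ≤ u ⬝ᵥ toReal z →
      ∫ ω, lyapunov α (u ⬝ᵥ toReal (S.step 0 z ω)) ∂P ≤ lyapunov α (u ⬝ᵥ toReal z) := by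
  obtain ⟨c, hc1, hc⟩ := EReal.lt_iff_exists_real_btwn.1 hliminf
  have hc1' : 1 < c := by exact_mod_cast hc1
  obtain ⟨κ, hκ, ε, hε, hdrift⟩ := exists_integral_lyapunov_le hα hδ0 hc1'
  obtain ⟨C, hC, hdev⟩ := hmom.exists_integral_lower_deviation_le hu (q := 2 + δ)
    (by linarith) (by linarith)
  let b := ∑ i, (u i)⁻¹
  have hb : 0 ≤ b := Finset.sum_nonneg fun i _ => (inv_pos.2 (hu.pos i)).le
  -- `κ'` converts the norm into the weight through `‖z‖ ≤ b * uᵀz`; `ε'` shares `ε` among the two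
  -- moments of each of the `p` types.
  let κ' := κ / (b + 1)
  have hκ' : 0 < κ' := by positivity
  let ε' := ε / (2 * C * p + 1)
  have hε' : 0 < ε' := by positivity
  have hle := hu.comap_dotProduct_le
  have hx : Tendsto (fun z => u ⬝ᵥ toReal z) (comap (fun z : Fin p → ℕ => u ⬝ᵥ toReal z) atTop)
    atTop := tendsto_comap
  have hall : ∀ᶠ z in comap (fun z : Fin p → ℕ => u ⬝ᵥ toReal z) atTop,
      ∫ ω, lyapunov α (u ⬝ᵥ toReal (S.step 0 z ω)) ∂P ≤ lyapunov α (u ⬝ᵥ toReal z) := by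
    filter_upwards [hx.eventually hdrift, hx.eventually (eventually_gt_atTop 1),
      hle (eventually_lt_of_lt_liminf hc),
      hle (eventually_all.2 fun i => (hB i).def hκ'),
      hle (eventually_all.2 hcond3_int), hle (eventually_all.2 hcond4_int),
      hle (eventually_all.2 fun i => (hcond3 i).def hε'),
      hle (eventually_all.2 fun i => (hcond4 i).def hε')]
      with z hz hx1 hquot hsmall hi3 hi4 ho3 ho4
    set x := u ⬝ᵥ toReal z with hxdef
    set g := u ⬝ᵥ S.h z with hgdef
    obtain ⟨hnum, hvar⟩ := pos_and_mul_le_of_lt_extQuotient (variance_nonneg _ _) (by linarith) hquot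
    have hg : 0 < g := by
      have : 0 < 2 * x := by linarith
      exact pos_of_mul_pos_right hnum this.le
    have hY := hmom.memLp_dotProduct_step hu (q := 2 + δ) (by linarith) hi4
    have hms : 0 ≤ S.momentScale u δ α z := by
      have : 0 < Real.log x := Real.log_pos hx1
      have h0 : 0 ≤ x := by linarith
      unfold momentScale
      rw [← hxdef, ← hgdef]
      positivity
    refine hz P _ g (S.sigmaSq u z) (S.measurable_dotProduct_step u z)
      (fun ω => hu.dotProduct_nonneg _) hY (hmom.integral_dotProduct_step hu z)
      (hmom.integral_sq_dotProduct_step hu hY) hg.le hvar ?_ ?_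
    · calc g ≤ ∑ i, u i * (κ' * ‖toReal z‖) := Finset.sum_le_sum fun i _ =>
            mul_le_mul_of_nonneg_left ((le_abs_self _).trans (by simpa using hsmall i))
              (hu.pos i).le
        _ = κ' * ‖toReal z‖ := by rw [← Finset.sum_mul, hu.sum_eq_one, one_mul]
        _ ≤ κ' * (b * x) := by gcongr; exact hu.norm_le z
        _ ≤ κ' * ((b + 1) * x) := by gcongr; linarith
        _ = κ * x := by simp only [κ']; field_simp
    · have hq : (2 + δ) / 2 = 1 + δ / 2 := by ring
      have h := hdev z hg.le (by simpa only [hq] using hi3) hi4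
      simp only [hq] at h
      refine h.trans ?_
      calc _ ≤ C * ∑ _i : Fin p, (ε' * S.momentScale u δ α z + ε' * S.momentScale u δ α z) := by
            gcongr with i
            · simpa [abs_of_nonneg hms] using (le_abs_self _).trans (ho3 i)
            · simpa [abs_of_nonneg hms] using (le_abs_self _).trans (ho4 i)
        _ = 2 * C * p * ε' * S.momentScale u δ α z := by
            rw [Finset.sum_const, Finset.card_univ, Fintype.card_fin, nsmul_eq_mul]
            ring
        _ ≤ ε * S.momentScale u δ α z := by
            gcongr
            have : ε = (2 * C * p + 1) * ε' := by simp only [ε']; field_simp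
            rw [this]
            linarith
        _ = _ := rfl
  obtain ⟨t, ht, hsub⟩ := hall
  obtain ⟨x₀, hx₀⟩ := mem_atTop_sets.1 ht
  exact ⟨max x₀ 0, le_max_right _ _, fun z hz => hsub (hx₀ _ ((le_max_left _ _).trans hz))⟩

/-! ### Supermartingale convergence and transience. -/

/-- A function of the composition which decreases in mean at each transition gives a
supermartingale. -/
lemma supermartingale_comp_Z [IsProbabilityMeasure P] (S : MBPM P p) {v : (Fin p → ℕ) → ℝ} {c : ℝ}
    (hv0 : ∀ z, 0 ≤ v z) (hvc : ∀ z, v z ≤ c) (hv : ∀ z, ∫ ω, v (S.step 0 z ω) ∂P ≤ v z) :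
    Supermartingale (fun n ω => v (S.Z n ω)) S.past P := by
  have hm : Measurable v := Measurable.of_discrete
  have hmn (n : ℕ) : Measurable fun ω => v (S.Z n ω) := hm.comp (S.measurable_Z_ambient n)
  have hint {f : Ω → Fin p → ℕ} (hf : Measurable f) : Integrable (fun ω => v (f ω)) P :=
    Integrable.of_bound (hm.comp hf).aestronglyMeasurable c (ae_of_all _ fun ω => by
      rw [Real.norm_of_nonneg (hv0 _)]; exact hvc _)
  refine supermartingale_of_setIntegral_succ_le
    (fun n => (hm.comp (S.measurable_Z n)).stronglyMeasurable)
    (fun n => hint (S.measurable_Z_ambient n)) fun n A hA => ?_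
  rw [integral_eq_lintegral_of_nonneg_ae (ae_of_all _ fun ω => hv0 _)
    (hmn (n + 1)).aestronglyMeasurable,
    integral_eq_lintegral_of_nonneg_ae (ae_of_all _ fun ω => hv0 _) (hmn n).aestronglyMeasurable]
  refine ENNReal.toReal_mono ?_ ?_
  · have := (hint (S.measurable_Z_ambient n)).integrableOn (s := A)
    have h := this.hasFiniteIntegral
    rw [hasFiniteIntegral_iff_ofReal (ae_of_all _ fun ω => hv0 _)] at h
    exact h.ne
  · rw [S.setLIntegral_Z_succ n hA fun z => ENNReal.ofReal (v z)]
    refine lintegral_mono fun ω => ?_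
    rw [← ofReal_integral_eq_lintegral_ofReal (hint (S.measurable_step 0 _))
      (ae_of_all _ fun ω => hv0 _)]
    exact ENNReal.ofReal_le_ofReal (hv _)

/-- Transience of the large compositions, from a Lyapunov function. -/
lemma measure_tendsto_pos [IsProbabilityMeasure P] (hg : S.GrowthPossible)
    (hnonnull : 0 < P {ω | ∃ n, S.Z n ω ≠ 0}) (hu : S.IsLeftPerron u) {α x₀ : ℝ} (hα : 0 < α)
    (hx₀ : 0 ≤ x₀) (hdrift : ∀ z : Fin p → ℕ, x₀ ≤ u ⬝ᵥ toReal z →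
      ∫ ω, lyapunov α (u ⬝ᵥ toReal (S.step 0 z ω)) ∂P ≤ lyapunov α (u ⬝ᵥ toReal z)) :
    0 < P {ω | Tendsto (fun n => ‖toReal (S.Z n ω)‖) atTop atTop} := by
  let F (z : Fin p → ℕ) : ℝ := lyapunov α (u ⬝ᵥ toReal z)
  let c := lyapunov α x₀
  have hc : 0 < c := lyapunov_pos α hx₀
  -- Below the threshold `x₀` the truncated function equals its maximum `c`, so no drift inequality
  -- is needed there.
  let v (z : Fin p → ℕ) : ℝ := min (F z) c
  let b := ∑ i, (u i)⁻¹
  have hb : 0 ≤ b := Finset.sum_nonneg fun i _ => (inv_pos.2 (hu.pos i)).le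
  have hF0 (z) : 0 ≤ F z := lyapunov_nonneg α (hu.dotProduct_nonneg z)
  have hFlt {z : Fin p → ℕ} {y : ℝ} (hy : 0 ≤ y) : F z < lyapunov α y ↔ y < u ⬝ᵥ toReal z :=
    (lyapunov_strictAntiOn hα).lt_iff_gt (hu.dotProduct_nonneg z) hy
  have hv0 (z) : 0 ≤ v z := le_min (hF0 z) hc.le
  have hvc (z) : v z ≤ c := min_le_right _ _
  have hFm : Measurable F := Measurable.of_discrete
  have hvm : Measurable v := Measurable.of_discrete
  have hint {f : Ω → Fin p → ℕ} (hf : Measurable f) : Integrable (fun ω => v (f ω)) P :=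
    Integrable.of_bound (hvm.comp hf).aestronglyMeasurable c (ae_of_all _ fun ω => by
      rw [Real.norm_of_nonneg (hv0 _)]; exact hvc _)
  have hv (z : Fin p → ℕ) : ∫ ω, v (S.step 0 z ω) ∂P ≤ v z := by
    have hi := hint (S.measurable_step 0 z)
    refine le_min ?_ ?_
    · rcases le_or_gt x₀ (u ⬝ᵥ toReal z) with h | h
      · refine le_trans (integral_mono hi ?_ fun ω => min_le_left _ _) (hdrift z h)
        exact Integrable.of_bound (hFm.comp (S.measurable_step 0 z)).aestronglyMeasurable 1
          (ae_of_all _ fun ω => by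
            change ‖F (S.step 0 z ω)‖ ≤ 1
            rw [Real.norm_of_nonneg (hF0 _)]
            exact lyapunov_le_one hα (hu.dotProduct_nonneg _))
      · have hcF : c ≤ F z := not_lt.1 fun h' => absurd ((hFlt hx₀).1 h') (not_lt.2 h.le)
        refine le_trans (integral_mono hi (integrable_const c) fun ω => hvc _) ?_
        simpa using hcF
    · refine le_trans (integral_mono hi (integrable_const c) fun ω => hvc _) ?_
      simp
  have hsup := supermartingale_comp_Z S hv0 hvc hv
  have hlim : ∀ᵐ ω ∂P, ∃ ℓ, Tendsto (fun n => v (S.Z n ω)) atTop (nhds ℓ) := by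
    have hbdd (n : ℕ) : eLpNorm ((-fun n ω => v (S.Z n ω)) n) 1 P ≤ (c.toNNReal : ENNReal) := by
      refine (eLpNorm_le_of_ae_bound (C := c) (ae_of_all _ fun ω => ?_)).trans (by simp)
      rw [Pi.neg_apply, Pi.neg_apply, norm_neg, Real.norm_of_nonneg (hv0 _)]
      exact hvc _
    filter_upwards [hsup.neg.ae_tendsto_limitProcess hbdd] with ω hω
    exact ⟨_, by simpa using hω.neg⟩
  have htrap : ∀ᵐ ω ∂P, ∀ N K : ℕ, ¬ ∀ n ≥ N, S.Z n ω ≠ 0 ∧ ∑ i, S.Z n ω i ≤ K :=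
    ae_all_iff.2 fun N => ae_all_iff.2 fun K =>
      measure_eq_zero_iff_ae_notMem.1 (S.measure_trapped_eq_zero hg N K)
  rw [pos_iff_ne_zero]
  intro hzero
  -- Limit `0` would mean divergence. A limit in `(0, c)` would keep the weight in `(x₀, B]` from
  -- some time on, hence the process among bounded non-null compositions.
  have hlimc : ∀ᵐ ω ∂P, Tendsto (fun n => v (S.Z n ω)) atTop (nhds c) := by
    filter_upwards [hlim, htrap, measure_eq_zero_iff_ae_notMem.1 hzero] with ω ⟨ℓ, hℓ⟩ ht hno
    have hℓ0 : 0 ≤ ℓ := ge_of_tendsto' hℓ fun n => hv0 _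
    have hℓc : ℓ ≤ c := le_of_tendsto' hℓ fun n => hvc _
    rcases hℓc.eq_or_lt with rfl | hlt
    · exact hℓ
    exfalso
    rcases hℓ0.eq_or_lt with rfl | hpos
    · refine hno (tendsto_atTop_mono (fun n => hu.dotProduct_le_norm _) ?_)
      refine tendsto_atTop.2 fun B => ?_
      filter_upwards [hℓ.eventually_lt_const (lt_min hc (lyapunov_pos α (le_max_right B 0)))]
        with n hn
      have h1 : F (S.Z n ω) < lyapunov α (max B 0) := by
        rcases min_lt_iff.1 (hn.trans_le (min_le_right _ _)) with h | h
        · exact h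
        · have h2 : v (S.Z n ω) < c := hn.trans_le (min_le_left _ _)
          rcases min_lt_iff.1 h2 with h3 | h3
          · exact h3.trans h
          · exact absurd h3 (lt_irrefl _)
      exact (le_max_left B 0).trans ((hFlt (le_max_right B 0)).1 h1).le
    · obtain ⟨B, hB0, hB⟩ := (((tendsto_lyapunov hα).eventually_lt_const (half_pos hpos)).and
        (eventually_ge_atTop 0)).exists
      obtain ⟨N, hN⟩ := eventually_atTop.1
        ((hℓ.eventually_lt_const hlt).and (hℓ.eventually_const_lt (half_lt_self hpos)))
      refine ht N ⌈b * B⌉₊ fun n hn => ?_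
      obtain ⟨h1, h2⟩ := hN n hn
      have hFc : x₀ < u ⬝ᵥ toReal (S.Z n ω) := by
        rcases min_lt_iff.1 h1 with h3 | h3
        · exact (hFlt hx₀).1 h3
        · exact absurd h3 (lt_irrefl _)
      have hxB : u ⬝ᵥ toReal (S.Z n ω) ≤ B := by
        by_contra! h
        exact absurd ((h2.trans_le (min_le_left _ _)).trans ((hFlt hB).2 h)) (not_lt.2 hB0.le)
      refine ⟨fun h0 => ?_, ?_⟩
      · rw [h0] at hFc
        have : u ⬝ᵥ toReal (0 : Fin p → ℕ) = 0 := by simp [dotProduct, toReal]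
        linarith
      · have h3 : ((∑ i, S.Z n ω i : ℕ) : ℝ) ≤ b * B :=
          (hu.sum_le _).trans (mul_le_mul_of_nonneg_left hxB hb)
        exact_mod_cast h3.trans (Nat.le_ceil _)
  -- The total size is at most `b * uᵀz`, so a size above `b * x₀` forces the weight beyond `x₀`,
  -- where `v < c`.
  obtain ⟨n₀, hn₀⟩ := S.exists_measure_large_pos hg hnonnull (⌊b * x₀⌋₊ + 1)
  have hlt : ∫ ω, v (S.Z n₀ ω) ∂P < c := by
    have hsub : Integrable (fun ω => c - v (S.Z n₀ ω)) P :=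
      (integrable_const c).sub (hint (S.measurable_Z_ambient n₀))
    have hpos : 0 < ∫ ω, (c - v (S.Z n₀ ω)) ∂P := by
      rw [integral_pos_iff_support_of_nonneg (fun ω => sub_nonneg.2 (hvc _)) hsub]
      refine hn₀.trans_le (measure_mono fun ω (hω : _ ≤ ∑ i, S.Z n₀ ω i) => ?_)
      have h1 : b * x₀ < b * (u ⬝ᵥ toReal (S.Z n₀ ω)) := by
        refine (Nat.lt_floor_add_one _).trans_le (le_trans ?_ (hu.sum_le (S.Z n₀ ω)))
        exact_mod_cast hω
      have h2 : F (S.Z n₀ ω) < c := (hFlt hx₀).2 (lt_of_mul_lt_mul_left h1 hb)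
      exact (sub_pos.2 ((min_le_left _ _).trans_lt h2)).ne'
    rw [integral_sub (integrable_const c) (hint (S.measurable_Z_ambient n₀))] at hpos
    simpa using hpos
  -- The means tend to `c` by bounded convergence, yet from `n₀` on they stay at most the mean at
  -- `n₀`, which is below `c`.
  have hconv : Tendsto (fun n => ∫ ω, v (S.Z n ω) ∂P) atTop (nhds (∫ _, c ∂P)) :=
    tendsto_integral_of_dominated_convergence (fun _ => c)
      (fun n => (hvm.comp (S.measurable_Z_ambient n)).aestronglyMeasurable) (integrable_const c)
      (fun n => ae_of_all _ fun ω => by rw [Real.norm_of_nonneg (hv0 _)]; exact hvc _) hlimc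
  have hle : ∫ _, c ∂P ≤ ∫ ω, v (S.Z n₀ ω) ∂P := by
    refine le_of_tendsto hconv ?_
    filter_upwards [eventually_ge_atTop n₀] with n hn
    simpa using hsup.setIntegral_le hn MeasurableSet.univ
  simp only [integral_const, probReal_univ, one_smul] at hle
  exact absurd hlt (not_lt.2 hle)

end MBPM
end Migration

theorem theorem2 {Ω : Type*} [MeasurableSpace Ω] (P : Measure Ω) [IsProbabilityMeasure P]
    (p : ℕ) (S : Migration.MBPM P p) (hmom : S.FiniteMoments)
    -- the process is not almost surely identically null
    (hnonnull : 0 < P {ω | ∃ n, S.Z n ω ≠ 0})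
    (hA : S.Critical) (hB : S.SmallMigration)
    (u : Fin p → ℝ) (hu : S.IsLeftPerron u)
    (hgrowth : S.GrowthPossible)
    (hliminf : 1 < liminf
      (fun z => Migration.extQuotient
        (2 * (u ⬝ᵥ Migration.toReal z) * (u ⬝ᵥ S.h z)) (S.sigmaSq u z))
      (Migration.normAtTop p))
    (δ α : ℝ) (hδ0 : 0 < δ) (hδ1 : δ ≤ 1) (hα : 0 < α)
    (hcond3_int : ∀ i, ∀ᶠ z in Migration.normAtTop p,
      Integrable (fun ω => |(z i : ℝ) + (S.M 0 z ω i : ℝ)| ^ (1 + δ / 2)) P)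
    (hcond3 : ∀ i, (fun z => ∫ ω, |(z i : ℝ) + (S.M 0 z ω i : ℝ)| ^ (1 + δ / 2) ∂P)
      =o[Migration.normAtTop p] S.momentScale u δ α)
    (hcond4_int : ∀ i, ∀ᶠ z in Migration.normAtTop p,
      Integrable (fun ω => |(S.M 0 z ω i : ℝ) - S.h z i| ^ (2 + δ)) P)
    (hcond4 : ∀ i, (fun z => ∫ ω, |(S.M 0 z ω i : ℝ) - S.h z i| ^ (2 + δ) ∂P)
      =o[Migration.normAtTop p] S.momentScale u δ α) :
    0 < P {ω | Tendsto (fun n => ‖Migration.toReal (S.Z n ω)‖) atTop atTop} := by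
  obtain ⟨x₀, hx₀, hdrift⟩ := Migration.MBPM.exists_integral_lyapunov_step_le hmom hB hu hliminf
    hδ0 hδ1 hα hcond3_int hcond3 hcond4_int hcond4
  exact Migration.MBPM.measure_tendsto_pos hgrowth hnonnull hu hα hx₀ hdrift
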